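/- Let the scalar field be $\mathbb{K}=\mathbb{R}$ or $\mathbb{C}$, and let $c_{00}$ be the space of finitely supported scalar sequences $x=(x_n)_{n=1}^\infty$; for $E\subseteq\mathbb{N}$ let $Ex$ be the restriction of $x$ to $E$ (zero off $E$). For $x\in c_{00}$ put $\|x\|_0=\max_n|x_n|$, \[ \|x\|_{m+1}=\max\Big\{\|x\|_m,\ \tfrac12\sup\sum_{j=1}^k\|E_jx\|_m\Big\},\qquad m\ge 0, \] the supremum being taken over all $k\in\mathbb{N}$ and all finite non-empty sets $E_1<E_2<\dots<E_k$ of positive integers with $k\le\min E_1$, and let $\|x\|_{\mathcal{T}}=\lim_m\|x\|_m$. For $0<r<\infty$ the $r$-convexified Tsirelson space $\mathcal{T}^{(r)}$ is the completion of $c_{00}$ under the norm (quasi-norm if $r<1$) $\|x\|=\big\|(|x_n|^r)_{n}\big\|_{\mathcal{T}}^{1/r}$. For $1<s\le\infty$ let $\mathcal{T}_*^{(s)}$ be the dual Banach space of $\mathcal{T}^{(r)}$, where $r=s/(s-1)$ ($r=1$ if $s=\infty$). A sequence $(x_n)_{n=1}^\infty$ in a quasi-Banach space is an unconditional basic sequence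 if every vector of its closed linear span has a unique expansion $\sum_n a_nx_n$ that converges unconditionally. Two sequences $(x_n)$ and $(y_n)$ are equivalent if there is a linear homeomorphism of the closed linear span of $(x_n)$ onto that of $(y_n)$ mapping $x_n$ to $y_n$ for every $n$. A subsymmetric basic sequence is an unconditional basic sequence that is equivalent to all its subsequences. Let $0<r<\infty$ and $1<s\le\infty$. Then neither $\mathcal{T}^{(r)}$ nor $\mathcal{T}_*^{(s)}$ contains a subsymmetric basic sequence. -/

import Mathlib

open scoped ENNReal
open Filter Topology

/-! ### Unconditional and subsymmetric basic sequences -/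

section Sequences

variable (𝕜 : Type*) [RCLike 𝕜] {E : Type*} [AddCommGroup E] [Module 𝕜 E] [TopologicalSpace E]

/-- `x` is an unconditional basic sequence: every vector `f` of the closed linear span of `x` has a
unique expansion `f = ∑ aₙ xₙ` with unconditional convergence (`HasSum` is convergence along the
net of finite subsets of `ℕ`). -/
def IsUnconditionalBasicSequence (x : ℕ → E) : Prop :=
  ∀ f ∈ closure (Submodule.span 𝕜 (Set.range x) : Set E),
    ∃! a : ℕ → 𝕜, HasSum (fun n => a n • x n) f

variable [ContinuousAdd E] [ContinuousConstSMul 𝕜 E]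

/-- The closed linear span of a sequence. -/
abbrev closedSpan (x : ℕ → E) : Submodule 𝕜 E :=
  (Submodule.span 𝕜 (Set.range x)).topologicalClosure

theorem mem_closedSpan (x : ℕ → E) (n : ℕ) : x n ∈ closedSpan 𝕜 x :=
  Submodule.le_topologicalClosure _ (Submodule.subset_span (Set.mem_range_self n))

/-- Two sequences are equivalent if some linear homeomorphism between their closed linear spans
maps `x n` to `y n` for every `n`. -/
def EquivalentSequences (x y : ℕ → E) : Prop :=
  ∃ T : closedSpan 𝕜 x ≃L[𝕜] closedSpan 𝕜 y, ∀ n : ℕ,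
    T ⟨x n, mem_closedSpan 𝕜 x n⟩ = ⟨y n, mem_closedSpan 𝕜 y n⟩

/-- A subsymmetric basic sequence: an unconditional basic sequence that is equivalent to all its
subsequences. -/
def IsSubsymmetricBasicSequence (x : ℕ → E) : Prop :=
  IsUnconditionalBasicSequence 𝕜 x ∧
    ∀ φ : ℕ → ℕ, StrictMono φ → EquivalentSequences 𝕜 x (x ∘ φ)

end Sequences

/-! ### The Tsirelson norm -/

/-- `E₁ < E₂ < ⋯ < E_k` are successive finite sets of coordinates with `k ≤ min E₁`, where the
natural number `n` stands for the coordinate `n + 1`. (Empty sets are harmless: they contribute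
nothing to the sums below.) -/
def TsirelsonAdmissible {k : ℕ} (E : Fin k → Finset ℕ) : Prop :=
  (∀ i, ∀ n ∈ E i, k ≤ n + 1) ∧ ∀ i j, i < j → ∀ a ∈ E i, ∀ b ∈ E j, a < b

/-- The iterated norms: `‖x‖₀` is the supremum norm and
`‖x‖ₘ₊₁ = max ‖x‖ₘ (1/2 sup ∑ⱼ ‖Eⱼ x‖ₘ)`, the supremum over the admissible families; `x` is a
sequence of non-negative numbers, to be thought of as the moduli of a scalar sequence. -/
noncomputable def tsirelsonAux : ℕ → (ℕ → ℝ≥0∞) → ℝ≥0∞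
  | 0, x => ⨆ n, x n
  | m + 1, x => max (tsirelsonAux m x)
      (⨆ (k : ℕ) (E : Fin k → Finset ℕ) (_ : TsirelsonAdmissible E),
        (∑ j, tsirelsonAux m ((E j : Set ℕ).indicator x)) / 2)

/-- The Tsirelson norm `sup_m ‖x‖ₘ = lim_m ‖x‖ₘ` (Figiel and Johnson) of a sequence of moduli. -/
noncomputable def tsirelsonNorm (x : ℕ → ℝ≥0∞) : ℝ≥0∞ := ⨆ m, tsirelsonAux m x

/-- The `r`-convexified norm `‖ |x|^r ‖^(1/r)` of a scalar sequence (a quasi-norm if `r < 1`). -/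
noncomputable def convexifiedNorm {𝕜 : Type*} [RCLike 𝕜] (r : ℝ) (x : ℕ → 𝕜) : ℝ≥0∞ :=
  (tsirelsonNorm fun n => ‖x n‖ₑ ^ r) ^ (1 / r)

theorem tsirelsonAux_mono (m : ℕ) {x y : ℕ → ℝ≥0∞} (h : x ≤ y) :
    tsirelsonAux m x ≤ tsirelsonAux m y := by
  induction m generalizing x y with
  | zero => exact iSup_mono h
  | succ m ih =>
    simp only [tsirelsonAux]
    refine max_le_max (ih h) ?_
    refine iSup_mono fun k => iSup_mono fun E => iSup_mono fun _ => ?_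
    refine ENNReal.div_le_div_right (Finset.sum_le_sum fun j _ => ih ?_) 2
    exact fun n => Set.indicator_le_indicator (h n)

theorem tsirelsonAux_add_le (m : ℕ) (x y : ℕ → ℝ≥0∞) :
    tsirelsonAux m (x + y) ≤ tsirelsonAux m x + tsirelsonAux m y := by
  induction m generalizing x y with
  | zero => exact iSup_le fun n => add_le_add (le_iSup x n) (le_iSup y n)
  | succ m ih =>
    simp only [tsirelsonAux]
    refine max_le ((ih x y).trans (add_le_add (le_max_left _ _) (le_max_left _ _))) ?_
    refine iSup_le fun k => iSup_le fun E => iSup_le fun hE => ?_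
    have h1 : (∑ j, tsirelsonAux m ((E j : Set ℕ).indicator (x + y))) / 2 ≤
        (∑ j, tsirelsonAux m ((E j : Set ℕ).indicator x)) / 2 +
          (∑ j, tsirelsonAux m ((E j : Set ℕ).indicator y)) / 2 := by
      rw [← ENNReal.add_div, ← Finset.sum_add_distrib]
      refine ENNReal.div_le_div_right (Finset.sum_le_sum fun j _ => ?_) 2
      rw [Set.indicator_add']
      exact ih _ _
    refine h1.trans (add_le_add (le_max_of_le_right ?_) (le_max_of_le_right ?_))
    · exact le_iSup_of_le k (le_iSup_of_le E (le_iSup_of_le hE le_rfl))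
    · exact le_iSup_of_le k (le_iSup_of_le E (le_iSup_of_le hE le_rfl))

theorem tsirelsonAux_mul_le (m : ℕ) (c : ℝ≥0∞) (x : ℕ → ℝ≥0∞) :
    tsirelsonAux m (fun n => c * x n) ≤ c * tsirelsonAux m x := by
  induction m generalizing x with
  | zero => exact iSup_le fun n => mul_le_mul_right (le_iSup x n) c
  | succ m ih =>
    simp only [tsirelsonAux]
    refine max_le ((ih x).trans (mul_le_mul_right (le_max_left _ _) c)) ?_
    refine iSup_le fun k => iSup_le fun E => iSup_le fun hE => ?_
    have h1 : (∑ j, tsirelsonAux m ((E j : Set ℕ).indicator fun n => c * x n)) / 2 ≤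
        c * ((∑ j, tsirelsonAux m ((E j : Set ℕ).indicator x)) / 2) := by
      rw [← mul_div_assoc, Finset.mul_sum]
      refine ENNReal.div_le_div_right (Finset.sum_le_sum fun j _ => ?_) 2
      have : ((E j : Set ℕ).indicator fun n => c * x n) =
          fun n => c * (E j : Set ℕ).indicator x n := by
        ext n
        by_cases hn : n ∈ (E j : Set ℕ) <;> simp [Set.indicator, hn]
      rw [this]
      exact ih _
    refine h1.trans (mul_le_mul_right (le_max_of_le_right ?_) c)
    exact le_iSup_of_le k (le_iSup_of_le E (le_iSup_of_le hE le_rfl))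

theorem tsirelsonAux_le_tsum (m : ℕ) (x : ℕ → ℝ≥0∞) : tsirelsonAux m x ≤ ∑' n, x n := by
  induction m generalizing x with
  | zero => exact iSup_le fun n => ENNReal.le_tsum n
  | succ m ih =>
    simp only [tsirelsonAux]
    refine max_le (ih x) (iSup_le fun k => iSup_le fun E => iSup_le fun hE => ?_)
    have h0 : ∀ n, ∑ j, (E j : Set ℕ).indicator x n ≤ x n := by
      intro n
      by_cases hn : ∃ j, n ∈ E j
      · obtain ⟨j, hj⟩ := hn
        rw [Finset.sum_eq_single j]
        · exact Set.indicator_le_self _ _ _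
        · intro i _ hij
          refine Set.indicator_of_notMem (fun hi => ?_) _
          rcases lt_or_gt_of_ne hij with h | h
          · exact lt_irrefl _ (hE.2 i j h n hi n hj)
          · exact lt_irrefl _ (hE.2 j i h n hj n hi)
        · intro h
          exact absurd (Finset.mem_univ _) h
      · push Not at hn
        rw [Finset.sum_eq_zero]
        · exact zero_le
        · intro j _
          exact Set.indicator_of_notMem (by simpa using hn j) _
    calc (∑ j, tsirelsonAux m ((E j : Set ℕ).indicator x)) / 2
        ≤ ∑ j, tsirelsonAux m ((E j : Set ℕ).indicator x) := ENNReal.half_le_self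
      _ ≤ ∑ j, ∑' n, (E j : Set ℕ).indicator x n := Finset.sum_le_sum fun j _ => ih _
      _ = ∑' n, ∑ j, (E j : Set ℕ).indicator x n :=
          (Summable.tsum_finsetSum fun _ _ => ENNReal.summable).symm
      _ ≤ ∑' n, x n := ENNReal.tsum_le_tsum h0

theorem tsirelsonNorm_mono {x y : ℕ → ℝ≥0∞} (h : x ≤ y) : tsirelsonNorm x ≤ tsirelsonNorm y :=
  iSup_mono fun m => tsirelsonAux_mono m h

theorem tsirelsonNorm_add_le (x y : ℕ → ℝ≥0∞) :
    tsirelsonNorm (x + y) ≤ tsirelsonNorm x + tsirelsonNorm y :=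
  iSup_le fun m => (tsirelsonAux_add_le m x y).trans
    (add_le_add (le_iSup (fun m => tsirelsonAux m x) m) (le_iSup (fun m => tsirelsonAux m y) m))

theorem tsirelsonNorm_mul_le (c : ℝ≥0∞) (x : ℕ → ℝ≥0∞) :
    tsirelsonNorm (fun n => c * x n) ≤ c * tsirelsonNorm x :=
  iSup_le fun m => (tsirelsonAux_mul_le m c x).trans
    (mul_le_mul_right (le_iSup (fun m => tsirelsonAux m x) m) c)

theorem le_tsirelsonNorm (x : ℕ → ℝ≥0∞) (n : ℕ) : x n ≤ tsirelsonNorm x :=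
  (le_iSup x n).trans (le_iSup (fun m => tsirelsonAux m x) 0)

section ConvexifiedNorm

variable {𝕜 : Type*} [RCLike 𝕜] {r : ℝ}

theorem enorm_le_convexifiedNorm (hr : 0 < r) (x : ℕ → 𝕜) (n : ℕ) :
    ‖x n‖ₑ ≤ convexifiedNorm r x := by
  have h := ENNReal.rpow_le_rpow (le_tsirelsonNorm (fun n => ‖x n‖ₑ ^ r) n)
    (one_div_nonneg.2 hr.le)
  rwa [← ENNReal.rpow_mul, mul_one_div_cancel hr.ne', ENNReal.rpow_one] at h

theorem convexifiedNorm_rpow (hr : 0 < r) (x : ℕ → 𝕜) :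
    convexifiedNorm r x ^ r = tsirelsonNorm fun n => ‖x n‖ₑ ^ r := by
  rw [convexifiedNorm, ← ENNReal.rpow_mul, one_div_mul_cancel hr.ne', ENNReal.rpow_one]

theorem convexifiedNorm_zero (hr : 0 < r) : convexifiedNorm r (0 : ℕ → 𝕜) = 0 := by
  have h := tsirelsonNorm_mul_le 0 (fun _ => 0)
  simp only [zero_mul, nonpos_iff_eq_zero] at h
  simp [convexifiedNorm, hr, h]

theorem convexifiedNorm_neg (x : ℕ → 𝕜) : convexifiedNorm r (-x) = convexifiedNorm r x := by
  simp [convexifiedNorm]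

theorem convexifiedNorm_smul_le (hr : 0 < r) (c : 𝕜) (x : ℕ → 𝕜) :
    convexifiedNorm r (c • x) ≤ ‖c‖ₑ * convexifiedNorm r x := by
  have h := tsirelsonNorm_mul_le (‖c‖ₑ ^ r) (fun n => ‖x n‖ₑ ^ r)
  rw [← convexifiedNorm_rpow hr, ← ENNReal.mul_rpow_of_nonneg _ _ hr.le] at h
  rw [← ENNReal.rpow_le_rpow_iff hr, convexifiedNorm_rpow hr]
  refine le_trans (le_of_eq ?_) h
  congr 1
  ext n
  rw [Pi.smul_apply, enorm_smul, ENNReal.mul_rpow_of_nonneg _ _ hr.le]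

theorem convexifiedNorm_smul (hr : 0 < r) (c : 𝕜) (x : ℕ → 𝕜) :
    convexifiedNorm r (c • x) = ‖c‖ₑ * convexifiedNorm r x := by
  refine le_antisymm (convexifiedNorm_smul_le hr c x) ?_
  rcases eq_or_ne c 0 with rfl | hc
  · simp
  · have h := convexifiedNorm_smul_le hr c⁻¹ (c • x)
    rw [inv_smul_smul₀ hc, enorm_inv hc] at h
    have hc0 : ‖c‖ₑ ≠ 0 := by simpa using hc
    calc ‖c‖ₑ * convexifiedNorm r x ≤ ‖c‖ₑ * (‖c‖ₑ⁻¹ * convexifiedNorm r (c • x)) :=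
          mul_le_mul_right h _
      _ = convexifiedNorm r (c • x) := by
          rw [← mul_assoc, ENNReal.mul_inv_cancel hc0 enorm_ne_top, one_mul]

theorem convexifiedNorm_eq_zero (hr : 0 < r) {x : ℕ → 𝕜} (h : convexifiedNorm r x = 0) :
    x = 0 := by
  ext n
  have := enorm_le_convexifiedNorm hr x n
  rw [h] at this
  simpa using this

theorem convexifiedNorm_lt_top (hr : 0 < r) (y : ℕ →₀ 𝕜) : convexifiedNorm r y < ⊤ := by
  refine ENNReal.rpow_lt_top_of_nonneg (one_div_nonneg.2 hr.le) (ne_of_lt ?_)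
  refine lt_of_le_of_lt (iSup_le fun m => tsirelsonAux_le_tsum m _) ?_
  rw [tsum_eq_sum (s := y.support)]
  · exact ENNReal.sum_lt_top.2 fun n _ => ENNReal.rpow_lt_top_of_nonneg hr.le enorm_ne_top
  · intro n hn
    simp [Finsupp.notMem_support_iff.1 hn, hr]

/-- The triangle inequality for `r ≥ 1`. -/
theorem convexifiedNorm_add_le (hr : 1 ≤ r) (x y : ℕ → 𝕜) :
    convexifiedNorm r (x + y) ≤ convexifiedNorm r x + convexifiedNorm r y := by
  have hr0 : 0 < r := one_pos.trans_le hr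
  rcases eq_or_ne (convexifiedNorm r x) 0 with hx | hx
  · rw [convexifiedNorm_eq_zero hr0 hx, zero_add]
    exact le_add_self
  rcases eq_or_ne (convexifiedNorm r y) 0 with hy | hy
  · rw [convexifiedNorm_eq_zero hr0 hy, add_zero]
    exact le_self_add
  rcases eq_or_ne (convexifiedNorm r x) ⊤ with hx' | hx'
  · simp [hx']
  rcases eq_or_ne (convexifiedNorm r y) ⊤ with hy' | hy'
  · simp [hy']
  have hX := convexifiedNorm_rpow hr0 x
  have hY := convexifiedNorm_rpow hr0 y
  set A := convexifiedNorm r x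
  set B := convexifiedNorm r y
  have hS : A + B ≠ 0 := by simp [hx]
  have hS' : A + B ≠ ⊤ := by simp [hx', hy']
  have hAr : A ^ r ≠ 0 := by simp [hx, hr0, hx']
  have hAr' : A ^ r ≠ ⊤ := ENNReal.rpow_ne_top_of_nonneg hr0.le hx'
  have hBr : B ^ r ≠ 0 := by simp [hy, hr0, hy']
  have hBr' : B ^ r ≠ ⊤ := ENNReal.rpow_ne_top_of_nonneg hr0.le hy'
  have hw : A / (A + B) + B / (A + B) = 1 := by
    rw [← ENNReal.add_div, ENNReal.div_self hS hS']
  have key : ∀ n, ‖(x + y) n‖ₑ ^ r ≤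
      (A + B) ^ r * (A / (A + B) * ((A ^ r)⁻¹ * ‖x n‖ₑ ^ r) +
        B / (A + B) * ((B ^ r)⁻¹ * ‖y n‖ₑ ^ r)) := by
    intro n
    have h1 := ENNReal.rpow_arith_mean_le_arith_mean2_rpow (A / (A + B)) (B / (A + B))
      (A⁻¹ * ‖x n‖ₑ) (B⁻¹ * ‖y n‖ₑ) hw hr
    rw [ENNReal.mul_rpow_of_nonneg _ _ hr0.le, ENNReal.mul_rpow_of_nonneg _ _ hr0.le,
      ENNReal.inv_rpow, ENNReal.inv_rpow] at h1
    refine le_trans ?_ (mul_le_mul_right h1 ((A + B) ^ r))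
    rw [← ENNReal.mul_rpow_of_nonneg _ _ hr0.le]
    refine ENNReal.rpow_le_rpow (le_trans (enorm_add_le _ _) (le_of_eq ?_)) hr0.le
    have e : ∀ C D t : ℝ≥0∞, C ≠ 0 → C ≠ ⊤ → D ≠ 0 → D ≠ ⊤ →
        D * (C / D * (C⁻¹ * t)) = t := by
      intro C D t h1 h2 h3 h4
      rw [← mul_assoc, ENNReal.mul_div_cancel h3 h4, ← mul_assoc, ENNReal.mul_inv_cancel h1 h2,
        one_mul]
    rw [mul_add, e A _ _ hx hx' hS hS', e B _ _ hy hy' hS hS']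
  rw [← ENNReal.rpow_le_rpow_iff hr0, convexifiedNorm_rpow hr0]
  refine (tsirelsonNorm_mono key).trans ((tsirelsonNorm_mul_le _ _).trans ?_)
  have h2 : tsirelsonNorm (fun n => A / (A + B) * ((A ^ r)⁻¹ * ‖x n‖ₑ ^ r) +
        B / (A + B) * ((B ^ r)⁻¹ * ‖y n‖ₑ ^ r)) ≤ 1 := by
    refine (tsirelsonNorm_add_le _ _).trans ?_
    rw [← hw]
    refine add_le_add ?_ ?_
    · refine (tsirelsonNorm_mul_le _ _).trans (mul_le_of_le_one_right' ?_)
      refine (tsirelsonNorm_mul_le _ _).trans ?_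
      rw [← hX, ENNReal.inv_mul_cancel hAr hAr']
    · refine (tsirelsonNorm_mul_le _ _).trans (mul_le_of_le_one_right' ?_)
      refine (tsirelsonNorm_mul_le _ _).trans ?_
      rw [← hY, ENNReal.inv_mul_cancel hBr hBr']
  exact mul_le_of_le_one_right' h2

/-- The `min r 1`-th power of the convexified (quasi-)norm is subadditive for every `r > 0`. -/
theorem convexifiedNorm_rpow_add_le (hr : 0 < r) (x y : ℕ → 𝕜) :
    convexifiedNorm r (x + y) ^ min r 1 ≤
      convexifiedNorm r x ^ min r 1 + convexifiedNorm r y ^ min r 1 := by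
  rcases le_total 1 r with h | h
  · simpa [min_eq_right h] using convexifiedNorm_add_le h x y
  · rw [min_eq_left h, convexifiedNorm_rpow hr, convexifiedNorm_rpow hr, convexifiedNorm_rpow hr]
    refine (tsirelsonNorm_mono fun n => ?_).trans (tsirelsonNorm_add_le _ _)
    exact (ENNReal.rpow_le_rpow (enorm_add_le _ _) hr.le).trans
      (ENNReal.rpow_add_le_add_rpow _ _ hr.le h)

end ConvexifiedNorm

/-! ### The spaces `T^(r)` and `T_*^(s)` -/

/-- The closure of the finitely supported sequences under the convexified (quasi-)norm, i.e. their
completion realised as a space of sequences. -/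
def tsirelsonSubmodule (𝕜 : Type*) [RCLike 𝕜] (r : ℝ) [hr : Fact (0 < r)] :
    Submodule 𝕜 (ℕ → 𝕜) where
  carrier := {x | ∀ ε : ℝ≥0∞, 0 < ε → ∃ y : ℕ →₀ 𝕜, convexifiedNorm r (x - ⇑y) < ε}
  zero_mem' := fun ε hε => ⟨0, by simpa [convexifiedNorm_zero hr.out] using hε⟩
  add_mem' := by
    intro a b ha hb ε hε
    have hp : 0 < min r 1 := lt_min hr.out one_pos
    have hδ : 0 < (ε ^ min r 1 / 2) ^ (min r 1)⁻¹ :=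
      ENNReal.rpow_pos_of_nonneg (ENNReal.half_pos (ENNReal.rpow_pos_of_nonneg hε hp.le).ne')
        (inv_nonneg.2 hp.le)
    obtain ⟨y, hy⟩ := ha _ hδ
    obtain ⟨z, hz⟩ := hb _ hδ
    refine ⟨y + z, ?_⟩
    rw [← ENNReal.rpow_lt_rpow_iff hp, ← ENNReal.rpow_mul, inv_mul_cancel₀ hp.ne',
      ENNReal.rpow_one] at hy hz
    rw [← ENNReal.rpow_lt_rpow_iff hp, Finsupp.coe_add, add_sub_add_comm]
    refine (convexifiedNorm_rpow_add_le hr.out _ _).trans_lt ?_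
    calc _ < ε ^ min r 1 / 2 + ε ^ min r 1 / 2 := ENNReal.add_lt_add hy hz
      _ = _ := ENNReal.add_halves _
  smul_mem' := by
    intro c x hx ε hε
    rcases eq_or_ne c 0 with rfl | hc
    · exact ⟨0, by simpa [convexifiedNorm_zero hr.out] using hε⟩
    have hc0 : ‖c‖ₑ ≠ 0 := by simpa using hc
    obtain ⟨y, hy⟩ := hx (ε / ‖c‖ₑ) (ENNReal.div_pos hε.ne' enorm_ne_top)
    refine ⟨c • y, ?_⟩
    rw [Finsupp.coe_smul, ← smul_sub, convexifiedNorm_smul hr.out, mul_comm]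
    exact (ENNReal.lt_div_iff_mul_lt (Or.inl hc0) (Or.inl enorm_ne_top)).1 hy

/-- The `r`-convexified Tsirelson space `T^(r)`, `0 < r < ∞`, over `𝕜 = ℝ` or `ℂ`. -/
def TsirelsonSpace (𝕜 : Type*) [RCLike 𝕜] (r : ℝ) [Fact (0 < r)] : Type _ :=
  ↥(tsirelsonSubmodule 𝕜 r)

namespace TsirelsonSpace

variable {𝕜 : Type*} [RCLike 𝕜] {r : ℝ}

instance [Fact (0 < r)] : AddCommGroup (TsirelsonSpace 𝕜 r) :=
  inferInstanceAs (AddCommGroup ↥(tsirelsonSubmodule 𝕜 r))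

instance [Fact (0 < r)] : Module 𝕜 (TsirelsonSpace 𝕜 r) :=
  inferInstanceAs (Module 𝕜 ↥(tsirelsonSubmodule 𝕜 r))

/-- The underlying scalar sequence. -/
def toSeq [Fact (0 < r)] : TsirelsonSpace 𝕜 r →ₗ[𝕜] (ℕ → 𝕜) :=
  (tsirelsonSubmodule 𝕜 r).subtype

theorem convexifiedNorm_toSeq_ne_top [hr : Fact (0 < r)] (x : TsirelsonSpace 𝕜 r) :
    convexifiedNorm r (toSeq x) ≠ ⊤ := by
  have hp : 0 < min r 1 := lt_min hr.out one_pos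
  obtain ⟨y, hy⟩ := (show ∀ ε : ℝ≥0∞, 0 < ε → ∃ y : ℕ →₀ 𝕜,
    convexifiedNorm r (toSeq x - ⇑y) < ε from x.2) 1 one_pos
  have h := convexifiedNorm_rpow_add_le hr.out (toSeq x - ⇑y) ⇑y
  rw [sub_add_cancel] at h
  intro htop
  rw [htop, ENNReal.top_rpow_of_pos hp, top_le_iff, ENNReal.add_eq_top] at h
  rcases h with h | h
  · exact ENNReal.rpow_ne_top_of_nonneg hp.le (hy.trans ENNReal.one_lt_top).ne h
  · exact ENNReal.rpow_ne_top_of_nonneg hp.le (convexifiedNorm_lt_top hr.out y).ne h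

/-- The translation-invariant metric of `T^(r)` is `‖x - y‖ ^ min r 1`, where `‖·‖` is the
convexified (quasi-)norm. For `r ≥ 1` the value of the field `norm` is the norm of `T^(r)` itself;
for `r < 1` it is the `r`-th power of the quasi-norm, which defines the quasi-norm topology. -/
noncomputable instance [hr : Fact (0 < r)] : NormedAddCommGroup (TsirelsonSpace 𝕜 r) :=
  AddGroupNorm.toNormedAddCommGroup
    { toFun := fun x => (convexifiedNorm r (toSeq x)).toReal ^ min r 1
      map_zero' := by
        have hp : 0 < min r 1 := lt_min hr.out one_pos
        simp [convexifiedNorm_zero hr.out, Real.zero_rpow hp.ne']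
      add_le' := by
        intro x y
        have hp : 0 < min r 1 := lt_min hr.out one_pos
        have h := convexifiedNorm_rpow_add_le hr.out (toSeq x) (toSeq y)
        have hx := ENNReal.rpow_ne_top_of_nonneg hp.le (convexifiedNorm_toSeq_ne_top x)
        have hy := ENNReal.rpow_ne_top_of_nonneg hp.le (convexifiedNorm_toSeq_ne_top y)
        rw [map_add, ENNReal.toReal_rpow, ENNReal.toReal_rpow, ENNReal.toReal_rpow,
          ← ENNReal.toReal_add hx hy]
        exact ENNReal.toReal_mono (ENNReal.add_ne_top.2 ⟨hx, hy⟩) h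
      neg' := by
        intro x
        rw [map_neg, convexifiedNorm_neg]
      eq_zero_of_map_eq_zero' := by
        intro x hx
        have hp : 0 < min r 1 := lt_min hr.out one_pos
        rw [Real.rpow_eq_zero ENNReal.toReal_nonneg hp.ne', ENNReal.toReal_eq_zero_iff] at hx
        have h := convexifiedNorm_eq_zero hr.out (hx.resolve_right (convexifiedNorm_toSeq_ne_top x))
        exact Subtype.ext h }

theorem norm_def [Fact (0 < r)] (x : TsirelsonSpace 𝕜 r) :
    ‖x‖ = (convexifiedNorm r (toSeq x)).toReal ^ min r 1 := rfl

theorem norm_smul_eq [hr : Fact (0 < r)] (c : 𝕜) (x : TsirelsonSpace 𝕜 r) :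
    ‖c • x‖ = ‖c‖ ^ min r 1 * ‖x‖ := by
  rw [norm_def, norm_def, map_smul, convexifiedNorm_smul hr.out, ENNReal.toReal_mul,
    Real.mul_rpow ENNReal.toReal_nonneg ENNReal.toReal_nonneg, toReal_enorm]

instance [Fact (0 < r)] : ContinuousConstSMul 𝕜 (TsirelsonSpace 𝕜 r) where
  continuous_const_smul c :=
    AddMonoidHomClass.continuous_of_bound (DistribSMul.toAddMonoidHom (TsirelsonSpace 𝕜 r) c)
      (‖c‖ ^ min r 1) fun x => (norm_smul_eq c x).le

instance fact_pos_of_one_le [h : Fact (1 ≤ r)] : Fact (0 < r) := ⟨one_pos.trans_le h.out⟩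

/-- For `r ≥ 1` the norm of `T^(r)` is the convexified norm. -/
theorem norm_eq [h : Fact (1 ≤ r)] (x : TsirelsonSpace 𝕜 r) :
    ‖x‖ = (convexifiedNorm r (toSeq x)).toReal := by
  rw [norm_def, min_eq_right h.out, Real.rpow_one]

noncomputable instance [h : Fact (1 ≤ r)] : NormedSpace 𝕜 (TsirelsonSpace 𝕜 r) where
  norm_smul_le c x := by
    rw [norm_smul_eq, min_eq_right h.out, Real.rpow_one]

end TsirelsonSpace

/-- The exponent `s / (s - 1) = 1 + 1 / (s - 1)` conjugate to `1 < s ≤ ∞`; it is `1` for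
`s = ∞`. -/
noncomputable def conjugateExponent (s : ℝ≥0∞) : ℝ := (ENNReal.conjExponent s).toReal

instance fact_one_le_conjugateExponent {s : ℝ≥0∞} [hs : Fact (1 < s)] :
    Fact (1 ≤ conjugateExponent s) := by
  have h0 : s - 1 ≠ 0 := (tsub_pos_of_lt hs.out).ne'
  refine ⟨?_⟩
  rw [conjugateExponent, ENNReal.conjExponent,
    ENNReal.toReal_add ENNReal.one_ne_top (ENNReal.inv_ne_top.2 h0), ENNReal.toReal_one]
  exact le_add_of_nonneg_right ENNReal.toReal_nonneg

/-- The space `T_*^(s)`, `1 < s ≤ ∞`: the Banach space dual of `T^(r)` with `r = s / (s - 1)`,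
with the dual norm. -/
abbrev TsirelsonDual (𝕜 : Type*) [RCLike 𝕜] (s : ℝ≥0∞) [Fact (1 < s)] : Type _ :=
  StrongDual 𝕜 (TsirelsonSpace 𝕜 (conjugateExponent s))

/-!
A subsymmetric basic sequence `x` has the same behaviour as all its subsequences. Along a
subsequence its coordinates converge, so the differences `x (2k) - x (2k + 1)` are coordinatewise
null and a gliding hump turns them into a block sequence `z` of the unit vector basis, bounded above
and below in norm, which still spreads: it is equivalent to its subsequences.

By definition of the norm, blocks which start far out in comparison with their number satisfy a
lower `ℓ_r` estimate. On the other hand some combinations of `z` with `ℓ_r`-normalised coefficients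
have arbitrarily small norm: passing to `|x_n| ^ r`, one needs small convex combinations of far-out
blocks `v 0, v 1, …` with norms at most `A`. If `v 0` lives below `L`, then an admissible family
which meets `v 0` has at most `L` members, so it sees at most `3 A / 4` of the average of the next
`2 L` blocks, and half the sum of `v 0` and that average has norm at most `7 A / 8`. Iterating makes
the norm as small as desired. Since `z` spreads, the coefficients of a small combination may be
moved far out, where the lower estimate contradicts smallness.

For the dual, let `1 ≤ r`. The same contraction, applied to vectors on which a functional has real
part at least `δ`, shows that the unit vector basis is shrinking, so the coordinate functionals are
a basis of the dual and the first step applies. Far-out blocks now satisfy the conjugate upper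
estimate, by Hölder's inequality and the lower estimate. But a functional which is large on small
combinations of norming vectors has large norm.
-/

open scoped NNReal

/-! ### The Tsirelson norm on sequences of moduli -/

theorem monotone_tsirelsonAux (x : ℕ → ℝ≥0∞) : Monotone fun m => tsirelsonAux m x :=
  monotone_nat_of_le_succ fun _ => le_max_left _ _

theorem TsirelsonAdmissible.sum_tsirelsonNorm_le {k : ℕ} {E : Fin k → Finset ℕ}
    (hE : TsirelsonAdmissible E) (x : ℕ → ℝ≥0∞) :
    (∑ j, tsirelsonNorm ((E j : Set ℕ).indicator x)) / 2 ≤ tsirelsonNorm x := by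
  simp only [tsirelsonNorm]
  rw [ENNReal.finsetSum_iSup_of_monotone fun j => monotone_tsirelsonAux _, ENNReal.iSup_div]
  refine iSup_le fun m => le_trans ?_ (le_iSup (fun m => tsirelsonAux m x) (m + 1))
  exact le_max_of_le_right (le_iSup_of_le k (le_iSup_of_le E (le_iSup_of_le hE le_rfl)))

theorem tsirelsonNorm_le_of_forall_admissible {x : ℕ → ℝ≥0∞} {A : ℝ≥0∞} (h0 : ∀ n, x n ≤ A)
    (h : ∀ (k : ℕ) (E : Fin k → Finset ℕ), TsirelsonAdmissible E →
      (∑ j, tsirelsonNorm ((E j : Set ℕ).indicator x)) / 2 ≤ A) : tsirelsonNorm x ≤ A := by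
  refine iSup_le fun m => ?_
  induction m with
  | zero => exact iSup_le h0
  | succ m ih =>
    refine max_le ih (iSup_le fun k => iSup_le fun E => iSup_le fun hE => le_trans ?_ (h k E hE))
    exact ENNReal.div_le_div_right (Finset.sum_le_sum fun j _ =>
      le_iSup (fun m => tsirelsonAux m ((E j : Set ℕ).indicator x)) m) 2

theorem tsirelsonNorm_smul_le (c : ℝ≥0) (x : ℕ → ℝ≥0∞) :
    tsirelsonNorm (c • x) ≤ c * tsirelsonNorm x :=
  tsirelsonNorm_mul_le c x

theorem tsirelsonNorm_zero : tsirelsonNorm (0 : ℕ → ℝ≥0∞) = 0 := by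
  simpa using tsirelsonNorm_smul_le 0 0

theorem tsirelsonNorm_indicator_le (s : Set ℕ) (x : ℕ → ℝ≥0∞) :
    tsirelsonNorm (s.indicator x) ≤ tsirelsonNorm x :=
  tsirelsonNorm_mono (Set.indicator_le_self s x)

theorem sum_tsirelsonNorm_indicator_smul_le {l : ℕ} (E : Fin l → Finset ℕ) (c : ℝ≥0)
    (x : ℕ → ℝ≥0∞) :
    ∑ i, tsirelsonNorm ((E i : Set ℕ).indicator (c • x)) ≤
      c * ∑ i, tsirelsonNorm ((E i : Set ℕ).indicator x) := by
  rw [Finset.mul_sum]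
  refine Finset.sum_le_sum fun i _ => ?_
  rw [show (E i : Set ℕ).indicator (c • x) = c • (E i : Set ℕ).indicator x from
    Set.indicator_const_smul (E i : Set ℕ) c x]
  exact tsirelsonNorm_smul_le _ _

theorem tsirelsonNorm_sum_le {ι : Type*} (s : Finset ι) (x : ι → ℕ → ℝ≥0∞) :
    tsirelsonNorm (∑ i ∈ s, x i) ≤ ∑ i ∈ s, tsirelsonNorm (x i) :=
  Finset.le_sum_of_subadditive _ tsirelsonNorm_zero.le tsirelsonNorm_add_le s x

theorem sum_tsirelsonNorm_Ico_le {N : ℕ → ℕ} (hN : StrictMono N) {θ : ℕ → ℕ} (hθ : StrictMono θ)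
    {s : Finset ℕ} (hs : ∀ k ∈ s, s.card ≤ θ k) (x : ℕ → ℝ≥0∞) :
    (∑ k ∈ s, tsirelsonNorm ((Set.Ico (N (θ k)) (N (θ k + 1))).indicator x)) / 2 ≤
      tsirelsonNorm x := by
  have hE : TsirelsonAdmissible fun j : Fin s.card =>
      Finset.Ico (N (θ (s.orderEmbOfFin rfl j))) (N (θ (s.orderEmbOfFin rfl j) + 1)) := by
    refine ⟨fun i n hn => ?_, fun i j hij a ha b hb => ?_⟩
    · have h1 := hs _ (s.orderEmbOfFin_mem rfl i)
      have h2 := hN.le_apply (x := θ (s.orderEmbOfFin rfl i))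
      have h3 := (Finset.mem_Ico.1 hn).1
      omega
    · have h1 : θ (s.orderEmbOfFin rfl i) + 1 ≤ θ (s.orderEmbOfFin rfl j) :=
        hθ ((s.orderEmbOfFin rfl).strictMono hij)
      exact (Finset.mem_Ico.1 ha).2.trans_le ((hN.monotone h1).trans (Finset.mem_Ico.1 hb).1)
  refine le_trans (le_of_eq ?_) (hE.sum_tsirelsonNorm_le x)
  congr 1
  have h := Finset.sum_image (s := Finset.univ) (g := s.orderEmbOfFin rfl)
    (f := fun k => tsirelsonNorm ((Set.Ico (N (θ k)) (N (θ k + 1))).indicator x))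
    (s.orderEmbOfFin rfl).injective.injOn
  rw [Finset.image_orderEmbOfFin_univ] at h
  simpa only [Finset.coe_Ico] using h

section FarOut

variable {v : ℕ → ℕ → ℝ≥0∞} {N : ℕ → ℕ} {A : ℝ≥0∞}

theorem card_meeting_pairs_le {l : ℕ} {E : Fin l → Finset ℕ}
    (hE : ∀ i j, i < j → ∀ a ∈ E i, ∀ b ∈ E j, a < b) (hN : Monotone N) (k : ℕ) :
    ((Finset.univ ×ˢ Finset.range k).filter fun p : Fin l × ℕ =>
      ∃ n ∈ E p.1, n ∈ Set.Ico (N p.2) (N (p.2 + 1))).card ≤ l + k := by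
  -- on the pairs that meet, `(i, j) ↦ i + j` is injective
  refine (Finset.card_le_card_of_injOn (fun p : Fin l × ℕ => (p.1 : ℕ) + p.2)
    (t := Finset.range (l + k)) ?_ ?_).trans_eq (Finset.card_range _)
  · intro p hp
    simp only [Finset.coe_filter, Finset.mem_product, Finset.mem_univ, Finset.mem_range, true_and,
      Set.mem_ofPred_eq] at hp
    have := p.1.2
    simp only [Finset.coe_range, Set.mem_Iio]
    omega
  · have le_of_lt : ∀ i i' : Fin l, ∀ j j' : ℕ, (∃ n ∈ E i, n ∈ Set.Ico (N j) (N (j + 1))) →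
        (∃ n ∈ E i', n ∈ Set.Ico (N j') (N (j' + 1))) → i < i' → j ≤ j' := by
      rintro i i' j j' ⟨n, hn, h1, -⟩ ⟨n', hn', -, h2'⟩ hi
      by_contra! hj
      have := hE i i' hi n hn n' hn'
      have := hN (show j' + 1 ≤ j from hj)
      omega
    rintro ⟨i, j⟩ hp ⟨i', j'⟩ hp' heq
    simp only [Finset.coe_filter, Finset.mem_product, Finset.mem_univ, Finset.mem_range, true_and,
      Set.mem_ofPred_eq] at hp hp' heq
    rcases lt_trichotomy i i' with h | rfl | h
    · have := le_of_lt i i' j j' hp.2 hp'.2 h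
      omega
    · simpa using heq
    · have := le_of_lt i' i j' j hp'.2 hp.2 h
      omega

theorem sum_tsirelsonNorm_indicator_sum_le {l : ℕ} {E : Fin l → Finset ℕ}
    (hE : ∀ i j, i < j → ∀ a ∈ E i, ∀ b ∈ E j, a < b) (hN : Monotone N)
    (hv : ∀ j, Function.support (v j) ⊆ Set.Ico (N j) (N (j + 1)))
    (hA : ∀ j, tsirelsonNorm (v j) ≤ A) (k : ℕ) :
    ∑ i, tsirelsonNorm ((E i : Set ℕ).indicator (∑ j ∈ Finset.range k, v j)) ≤
      (l + k : ℕ) * A := by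
  classical
  calc ∑ i, tsirelsonNorm ((E i : Set ℕ).indicator (∑ j ∈ Finset.range k, v j))
      ≤ ∑ i, ∑ j ∈ Finset.range k, tsirelsonNorm ((E i : Set ℕ).indicator (v j)) := by
        refine Finset.sum_le_sum fun i _ => ?_
        rw [Finset.indicator_sum]
        exact tsirelsonNorm_sum_le _ _
    _ = ∑ p ∈ Finset.univ ×ˢ Finset.range k, tsirelsonNorm ((E p.1 : Set ℕ).indicator (v p.2)) :=
        (Finset.sum_product' _ _ _).symm
    _ ≤ ∑ p ∈ Finset.univ ×ˢ Finset.range k,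
          if ∃ n ∈ E p.1, n ∈ Set.Ico (N p.2) (N (p.2 + 1)) then A else 0 := by
        refine Finset.sum_le_sum fun p _ => ?_
        split_ifs with hp
        · exact (tsirelsonNorm_indicator_le _ _).trans (hA _)
        · have hdisj : Disjoint (E p.1 : Set ℕ) (Function.support (v p.2)) :=
            Set.disjoint_left.2 fun n hn hn' => hp ⟨n, hn, hv _ hn'⟩
          rw [Set.indicator_eq_zero'.2 hdisj.symm, tsirelsonNorm_zero]
    _ ≤ (l + k : ℕ) * A := by
        rw [← Finset.sum_filter, Finset.sum_const, nsmul_eq_mul]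
        gcongr
        exact card_meeting_pairs_le hE hN k

/-- An admissible family which meets `f` has at most `L` members, whatever it does on `g`. -/
theorem tsirelsonNorm_add_le_max {f g : ℕ → ℝ≥0∞} {L : ℕ} {γ : ℝ≥0∞}
    (hf : Function.support f ⊆ Set.Iio L) (hg : Function.support g ⊆ Set.Ici L)
    (hγ : ∀ (l : ℕ) (E : Fin l → Finset ℕ), l ≤ L → TsirelsonAdmissible E →
      (∑ i, tsirelsonNorm ((E i : Set ℕ).indicator g)) / 2 ≤ γ) :
    tsirelsonNorm (f + g) ≤ max (tsirelsonNorm f + γ) (tsirelsonNorm g) := by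
  refine tsirelsonNorm_le_of_forall_admissible (fun n => ?_) fun l E hE => ?_
  · rcases lt_or_ge n L with hn | hn
    · have hgn : g n = 0 := by_contra fun h => (hg h).not_gt hn
      rw [Pi.add_apply, hgn, add_zero]
      exact le_max_of_le_left ((le_tsirelsonNorm f n).trans le_self_add)
    · have hfn : f n = 0 := by_contra fun h => (hf h).not_ge hn
      rw [Pi.add_apply, hfn, zero_add]
      exact le_max_of_le_right (le_tsirelsonNorm g n)
  by_cases hmeet : ∃ i, ∃ n ∈ E i, n < L
  · obtain ⟨i, n, hn, hnL⟩ := hmeet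
    refine le_max_of_le_left ?_
    calc (∑ i, tsirelsonNorm ((E i : Set ℕ).indicator (f + g))) / 2
        ≤ (∑ i, tsirelsonNorm ((E i : Set ℕ).indicator f)) / 2 +
          (∑ i, tsirelsonNorm ((E i : Set ℕ).indicator g)) / 2 := by
          rw [← ENNReal.add_div, ← Finset.sum_add_distrib]
          gcongr with j
          rw [Set.indicator_add']
          exact tsirelsonNorm_add_le _ _
      _ ≤ tsirelsonNorm f + γ :=
          add_le_add (hE.sum_tsirelsonNorm_le f) (hγ l E ((hE.1 i n hn).trans hnL) hE)
  · push Not at hmeet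
    have hEf : ∀ i, (E i : Set ℕ).indicator f = 0 := fun i =>
      Set.indicator_eq_zero'.2 (Set.disjoint_left.2 fun n hn hn' => (hmeet i n hn').not_gt (hf hn))
    simp only [Set.indicator_add', hEf, zero_add]
    exact le_max_of_le_right (hE.sum_tsirelsonNorm_le g)

theorem support_sum_subset {s : Finset ℕ} {t : Set ℕ}
    (h : ∀ j ∈ s, Function.support (v j) ⊆ t) : Function.support (∑ j ∈ s, v j) ⊆ t := by
  refine Function.support_subset_iff'.2 fun n hn => ?_
  rw [Finset.sum_apply]
  exact Finset.sum_eq_zero fun j hj => Function.support_subset_iff'.1 (h j hj) n hn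

theorem tsirelsonNorm_average_le (hA : ∀ j, tsirelsonNorm (v j) ≤ A) {k : ℕ} (hk : k ≠ 0) :
    tsirelsonNorm ((k : ℝ≥0)⁻¹ • ∑ j ∈ Finset.range k, v j) ≤ A := by
  calc tsirelsonNorm ((k : ℝ≥0)⁻¹ • ∑ j ∈ Finset.range k, v j)
      ≤ ((k : ℝ≥0)⁻¹ : ℝ≥0) * ∑ j ∈ Finset.range k, tsirelsonNorm (v j) :=
        (tsirelsonNorm_smul_le _ _).trans (by gcongr; exact tsirelsonNorm_sum_le _ _)
    _ ≤ ((k : ℝ≥0)⁻¹ : ℝ≥0) * ∑ _j ∈ Finset.range k, A := by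
        gcongr
        exact hA _
    _ = ((k : ℝ≥0)⁻¹ * k : ℝ≥0) * A := by
        rw [Finset.sum_const, Finset.card_range, nsmul_eq_mul, ENNReal.coe_mul,
          ENNReal.coe_natCast, mul_assoc]
    _ = A := by rw [inv_mul_cancel₀ (Nat.cast_ne_zero.2 hk), ENNReal.coe_one, one_mul]

theorem sum_tsirelsonNorm_indicator_average_le {l L : ℕ} (hl : l ≤ L) (hL : L ≠ 0)
    {E : Fin l → Finset ℕ} (hE : ∀ i j, i < j → ∀ a ∈ E i, ∀ b ∈ E j, a < b) (hN : Monotone N)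
    (hv : ∀ j, Function.support (v j) ⊆ Set.Ico (N j) (N (j + 1)))
    (hA : ∀ j, tsirelsonNorm (v j) ≤ A) :
    ∑ i, tsirelsonNorm ((E i : Set ℕ).indicator
      (((2 * L : ℕ) : ℝ≥0)⁻¹ • ∑ j ∈ Finset.range (2 * L), v j)) ≤ (3 / 2 : ℝ≥0) * A := by
  set c : ℝ≥0 := ((2 * L : ℕ) : ℝ≥0)⁻¹
  calc ∑ i, tsirelsonNorm ((E i : Set ℕ).indicator (c • ∑ j ∈ Finset.range (2 * L), v j))
      ≤ c * ∑ i, tsirelsonNorm ((E i : Set ℕ).indicator (∑ j ∈ Finset.range (2 * L), v j)) :=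
        sum_tsirelsonNorm_indicator_smul_le _ _ _
    _ ≤ c * ((L + 2 * L : ℕ) * A) := by
        gcongr
        exact (sum_tsirelsonNorm_indicator_sum_le hE hN hv hA _).trans (by gcongr)
    _ = (c * (L + 2 * L : ℕ) : ℝ≥0) * A := by
        rw [ENNReal.coe_mul, ENNReal.coe_natCast, mul_assoc]
    _ = (3 / 2 : ℝ≥0) * A := by
        congr 2
        simp only [c]
        push_cast
        field_simp
        norm_num

theorem tsirelsonNorm_half_add_half_average_le (hN : Monotone N) (hN1 : N 1 ≠ 0)
    (hv : ∀ j, Function.support (v j) ⊆ Set.Ico (N j) (N (j + 1)))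
    (hA : ∀ j, tsirelsonNorm (v j) ≤ A) :
    tsirelsonNorm ((2⁻¹ : ℝ≥0) • v 0 +
      (2⁻¹ : ℝ≥0) • ((2 * N 1 : ℕ) : ℝ≥0)⁻¹ • ∑ j ∈ Finset.range (2 * N 1), v (j + 1)) ≤
      (7 / 8 : ℝ≥0) * A := by
  set S := ((2 * N 1 : ℕ) : ℝ≥0)⁻¹ • ∑ j ∈ Finset.range (2 * N 1), v (j + 1)
  have half : ∀ x, tsirelsonNorm x ≤ A → tsirelsonNorm ((2⁻¹ : ℝ≥0) • x) ≤ (2⁻¹ : ℝ≥0) * A :=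
    fun x hx => (tsirelsonNorm_smul_le _ _).trans (by gcongr)
  have few_sets : ∀ (l : ℕ) (E : Fin l → Finset ℕ), l ≤ N 1 → TsirelsonAdmissible E →
      (∑ i, tsirelsonNorm ((E i : Set ℕ).indicator ((2⁻¹ : ℝ≥0) • S))) / 2 ≤
        (3 / 8 : ℝ≥0) * A := by
    intro l E hl hE
    have h := sum_tsirelsonNorm_indicator_average_le hl hN1 hE.2
      (fun _ _ h => hN (Nat.succ_le_succ h)) (fun j => hv (j + 1)) fun j => hA (j + 1)
    calc _ ≤ ((2⁻¹ : ℝ≥0) * ((3 / 2 : ℝ≥0) * A)) / 2 := by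
          gcongr
          exact (sum_tsirelsonNorm_indicator_smul_le _ _ _).trans (mul_le_mul_right h _)
      _ = (2⁻¹ * 2⁻¹ * (3 / 2) : ℝ≥0) * A := by
          rw [div_eq_mul_inv, mul_comm, ← mul_assoc, ← mul_assoc, ← ENNReal.coe_inv_two,
            ← ENNReal.coe_mul, ← ENNReal.coe_mul]
      _ = (3 / 8 : ℝ≥0) * A := by norm_num
  refine (tsirelsonNorm_add_le_max (L := N 1) ?_ ?_ few_sets).trans (max_le ?_ ?_)
  · exact (Function.support_const_smul_subset _ _).trans ((hv 0).trans fun n hn => hn.2)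
  · refine (Function.support_const_smul_subset _ _).trans
      ((Function.support_const_smul_subset _ _).trans (support_sum_subset fun j _ => ?_))
    exact (hv _).trans fun n hn => (hN (by omega)).trans hn.1
  · calc _ ≤ ((2⁻¹ : ℝ≥0) * A + (3 / 8 : ℝ≥0) * A : ℝ≥0∞) := by gcongr; exact half _ (hA 0)
      _ = _ := by rw [← add_mul, ← ENNReal.coe_add]; norm_num
  · refine (half _ (tsirelsonNorm_average_le (fun j => hA _) (by omega))).trans ?_
    gcongr
    rw [← NNReal.coe_le_coe]
    norm_num

end FarOut

theorem average_mem_of_convex {E : Type*} [AddCommMonoid E] [Module ℝ≥0 E] {C : Set E}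
    (hC : Convex ℝ≥0 C) {v : ℕ → E} (hv : ∀ j, v j ∈ C) (k : ℕ) :
    ((k + 1 : ℕ) : ℝ≥0)⁻¹ • ∑ j ∈ Finset.range (k + 1), v j ∈ C := by
  induction k with
  | zero => simpa using hv 0
  | succ k ih =>
    have h := hC ih (hv (k + 1)) (zero_le (a := (k + 1) / ((k + 1 + 1 : ℕ) : ℝ≥0)))
      (zero_le (a := ((k + 1 + 1 : ℕ) : ℝ≥0)⁻¹)) (by push_cast; field_simp)
    rw [Finset.sum_range_succ, smul_add]
    convert h using 2
    rw [smul_smul]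
    congr 1
    push_cast
    field_simp

section ConvexSets

variable {C : Set (ℕ → ℝ≥0∞)}

/-- `C` contains, beyond every coordinate, a finitely supported sequence of norm at most `A`. -/
def HasFarElements (C : Set (ℕ → ℝ≥0∞)) (A : ℝ≥0∞) : Prop :=
  ∀ N, ∃ x ∈ C, (∃ M, Function.support x ⊆ Set.Ico N M) ∧ tsirelsonNorm x ≤ A

theorem HasFarElements.contract {A : ℝ≥0∞} (h : HasFarElements C A) (hC : Convex ℝ≥0 C) :
    HasFarElements C ((7 / 8 : ℝ≥0) * A) := by
  intro N₀
  choose F hFC hFM hFA using h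
  choose G hG using hFM
  obtain ⟨N, rfl, hN1⟩ : ∃ N : ℕ → ℕ, N 0 = N₀ ∧ ∀ j, N (j + 1) = max (G (N j)) (N j + 1) :=
    ⟨fun j => Nat.rec N₀ (fun _ m => max (G m) (m + 1)) j, rfl, fun j => rfl⟩
  have hN : StrictMono N := strictMono_nat_of_lt_succ fun j => by rw [hN1]; omega
  have hv : ∀ j, Function.support (F (N j)) ⊆ Set.Ico (N j) (N (j + 1)) := fun j =>
    (hG _).trans (Set.Ico_subset_Ico_right (by rw [hN1]; omega))
  have hL : N 1 ≠ 0 := ((Nat.zero_le _).trans_lt (hN one_pos)).ne'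
  refine ⟨_, hC (hFC (N 0)) ?_ (zero_le (a := 2⁻¹)) (zero_le (a := 2⁻¹)) (by norm_num), ?_,
    tsirelsonNorm_half_add_half_average_le hN.monotone hL hv fun j => hFA _⟩
  · have h := average_mem_of_convex hC (fun j => hFC (N (j + 1))) (2 * N 1 - 1)
    rwa [show 2 * N 1 - 1 + 1 = 2 * N 1 by omega] at h
  · refine ⟨N (2 * N 1 + 1), (Function.support_add _ _).trans (Set.union_subset ?_ ?_)⟩
    · exact (Function.support_const_smul_subset _ _).trans
        ((hv 0).trans (Set.Ico_subset_Ico_right (hN.monotone (by omega))))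
    · refine (Function.support_const_smul_subset _ _).trans
        ((Function.support_const_smul_subset _ _).trans ?_)
      refine support_sum_subset fun j hj => (hv _).trans ?_
      have := Finset.mem_range.1 hj
      exact Set.Ico_subset_Ico (hN.monotone (by omega)) (hN.monotone (by omega))

theorem HasFarElements.exists_tsirelsonNorm_lt {B : ℝ≥0∞} (h : HasFarElements C B) (hB : B ≠ ⊤)
    (hC : Convex ℝ≥0 C) {c : ℝ≥0∞} (hc : 0 < c) : ∃ x ∈ C, tsirelsonNorm x < c := by
  have hfar : ∀ m : ℕ, HasFarElements C (((7 / 8 : ℝ≥0) : ℝ≥0∞) ^ m * B) := by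
    intro m
    induction m with
    | zero => simpa using h
    | succ m ih => simpa only [pow_succ', mul_assoc] using ih.contract hC
  have hlim : Tendsto (fun m : ℕ => ((7 / 8 : ℝ≥0) : ℝ≥0∞) ^ m * B) atTop (𝓝 0) := by
    have h78 : ((7 / 8 : ℝ≥0) : ℝ≥0∞) < 1 := by
      rw [← ENNReal.coe_one, ENNReal.coe_lt_coe, div_lt_one (by norm_num)]
      norm_num
    simpa using ENNReal.Tendsto.mul_const
      (ENNReal.tendsto_pow_atTop_nhds_zero_of_lt_one h78) (Or.inr hB)
  obtain ⟨m, hm⟩ := (hlim.eventually (gt_mem_nhds hc)).exists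
  obtain ⟨x, hxC, -, hx⟩ := hfar m 0
  exact ⟨x, hxC, hx.trans_lt hm⟩

theorem exists_convex_combination_tsirelsonNorm_lt {w : ℕ → ℕ → ℝ≥0∞} {N : ℕ → ℕ}
    (hN : StrictMono N) (hw : ∀ j, Function.support (w j) ⊆ Set.Ico (N j) (N (j + 1)))
    {B : ℝ≥0∞} (hB : B ≠ ⊤) (hwB : ∀ j, tsirelsonNorm (w j) ≤ B) (K : ℕ) {c : ℝ≥0∞} (hc : 0 < c) :
    ∃ (s : Finset ℕ) (a : ℕ → ℝ≥0), (∀ k ∈ s, K ≤ k) ∧ ∑ k ∈ s, a k = 1 ∧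
      tsirelsonNorm (∑ k ∈ s, a k • w k) < c := by
  let D : Set (ℕ →₀ ℝ≥0) := {a | (∀ k, k < K → a k = 0) ∧
    Finsupp.linearCombination ℝ≥0 (fun _ : ℕ => (1 : ℝ≥0)) a = 1}
  have hD : Convex ℝ≥0 D := by
    rintro a ⟨haK, ha⟩ b ⟨hbK, hb⟩ t u - - htu
    exact ⟨fun k hk => by simp [haK k hk, hbK k hk], by simp [ha, hb, htu]⟩
  have hfar : HasFarElements (Finsupp.linearCombination ℝ≥0 w '' D) B := by
    intro M
    refine ⟨w (max K M), ⟨Finsupp.single (max K M) 1, ⟨fun k hk => ?_, by simp⟩, by simp⟩,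
      ⟨N (max K M + 1), (hw _).trans (Set.Ico_subset_Ico_left ?_)⟩, hwB _⟩
    · exact Finsupp.single_eq_of_ne (by omega)
    · exact (le_max_right K M).trans hN.le_apply
  obtain ⟨_, ⟨a, ⟨haK, ha⟩, rfl⟩, hx⟩ :=
    hfar.exists_tsirelsonNorm_lt hB (hD.linear_image _) hc
  refine ⟨a.support, a, fun k hk => ?_, ?_, hx⟩
  · exact le_of_not_gt fun h => Finsupp.mem_support_iff.1 hk (haK k h)
  · simpa [Finsupp.linearCombination_apply, Finsupp.sum] using ha

end ConvexSets

/-! ### Homogeneous norms and domination of sequences -/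

section Domination

variable {𝕜 : Type*} [RCLike 𝕜] {E F : Type*} [NormedAddCommGroup E] [Module 𝕜 E]
  [NormedAddCommGroup F] [Module 𝕜 F] {p : ℝ}

variable (𝕜 E) in
/-- The norm of `E` is homogeneous of degree `p`, so that `‖·‖ ^ (1 / p)` is a quasi-norm; this
covers the `p`-normed spaces with `p < 1` as well as the normed spaces, for which `p = 1`. -/
structure IsHomogeneousNorm (p : ℝ) : Prop where
  pos : 0 < p
  norm_smul : ∀ (c : 𝕜) (x : E), ‖c • x‖ = ‖c‖ ^ p * ‖x‖

namespace IsHomogeneousNorm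

theorem submodule (hE : IsHomogeneousNorm 𝕜 E p) (G : Submodule 𝕜 E) :
    IsHomogeneousNorm 𝕜 G p :=
  ⟨hE.pos, fun c x => hE.norm_smul c x⟩

theorem tendsto_smul_zero (hE : IsHomogeneousNorm 𝕜 E p) {c : ℕ → 𝕜}
    (hc : Tendsto c atTop (𝓝 0)) (v : E) : Tendsto (fun k => c k • v) atTop (𝓝 0) := by
  rw [tendsto_zero_iff_norm_tendsto_zero]
  simp only [hE.norm_smul]
  simpa [Real.zero_rpow hE.pos.ne'] using
    (hc.norm.rpow_const (p := p) (Or.inr hE.pos.le)).mul_const ‖v‖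

theorem exists_norm_le_of_continuous (hE : IsHomogeneousNorm 𝕜 E p)
    (hF : IsHomogeneousNorm 𝕜 F p) (T : E →L[𝕜] F) : ∃ C, 0 < C ∧ ∀ x, ‖T x‖ ≤ C * ‖x‖ := by
  obtain ⟨δ, hδ, hT⟩ := Metric.continuousAt_iff.1 T.continuous.continuousAt 1 one_pos
  refine ⟨2 / δ, by positivity, fun x => ?_⟩
  rcases eq_or_ne x 0 with rfl | hx
  · simp
  have hx0 : 0 < ‖x‖ := norm_pos_iff.2 hx
  set t : ℝ := (δ / 2 / ‖x‖) ^ p⁻¹ with ht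
  have htp : ‖(t : 𝕜)‖ ^ p = δ / 2 / ‖x‖ := by
    rw [RCLike.norm_ofReal, abs_of_nonneg (by positivity), ht, ← Real.rpow_mul (by positivity),
      inv_mul_cancel₀ hE.pos.ne', Real.rpow_one]
  have htx : dist ((t : 𝕜) • x) 0 < δ := by
    rw [dist_zero_right, hE.norm_smul, htp, div_mul_cancel₀ _ hx0.ne']
    exact half_lt_self hδ
  have hTtx := hT htx
  rw [map_smul, map_zero, dist_zero_right, hF.norm_smul, htp, div_mul_eq_mul_div,
    div_lt_one hx0] at hTtx
  rw [div_mul_eq_mul_div, le_div_iff₀ hδ]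
  linarith

end IsHomogeneousNorm

variable (𝕜) in
/-- The sequence `x` dominates `y`: the map `∑ aₙ xₙ ↦ ∑ aₙ yₙ` is bounded on finite sums. -/
def Dominates (x y : ℕ → E) : Prop :=
  ∃ C : ℝ, 0 < C ∧ ∀ a : ℕ →₀ 𝕜,
    ‖Finsupp.linearCombination 𝕜 y a‖ ≤ C * ‖Finsupp.linearCombination 𝕜 x a‖

namespace Dominates

variable {x y z : ℕ → E}

theorem trans (hxy : Dominates 𝕜 x y) (hyz : Dominates 𝕜 y z) : Dominates 𝕜 x z := by
  obtain ⟨C, hC, hxy⟩ := hxy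
  obtain ⟨D, hD, hyz⟩ := hyz
  refine ⟨D * C, mul_pos hD hC, fun a => (hyz a).trans ?_⟩
  rw [mul_assoc]
  exact mul_le_mul_of_nonneg_left (hxy a) hD.le

theorem linearCombination (h : Dominates 𝕜 x y) (u : ℕ → ℕ →₀ 𝕜) :
    Dominates 𝕜 (fun k => Finsupp.linearCombination 𝕜 x (u k))
      fun k => Finsupp.linearCombination 𝕜 y (u k) := by
  obtain ⟨C, hC, h⟩ := h
  refine ⟨C, hC, fun a => ?_⟩
  simpa only [Finsupp.linearCombination_linearCombination] using
    h (Finsupp.linearCombination 𝕜 u a)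

theorem exists_norm_sum_le (h : Dominates 𝕜 x y) : ∃ C : ℝ, 0 < C ∧
    ∀ (s : Finset ℕ) (a : ℕ → 𝕜), ‖∑ k ∈ s, a k • y k‖ ≤ C * ‖∑ k ∈ s, a k • x k‖ := by
  obtain ⟨C, hC, h⟩ := h
  refine ⟨C, hC, fun s a => ?_⟩
  simpa using h (∑ k ∈ s, Finsupp.single k (a k))

theorem exists_norm_le (h : Dominates 𝕜 x y) : ∃ C : ℝ, 0 < C ∧ ∀ n, ‖y n‖ ≤ C * ‖x n‖ := by
  obtain ⟨C, hC, h⟩ := h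
  exact ⟨C, hC, fun n => by simpa using h (Finsupp.single n 1)⟩

end Dominates

variable (𝕜) in
/-- The sequence `x` and each of its subsequences dominate each other: the part of subsymmetry
which remains when the closed linear spans are forgotten. -/
def IsSpreading (x : ℕ → E) : Prop :=
  ∀ θ : ℕ → ℕ, StrictMono θ → Dominates 𝕜 x (x ∘ θ) ∧ Dominates 𝕜 (x ∘ θ) x

theorem bddAbove_range_of_forall_subseq_le {f : ℕ → ℝ} (hf : ∀ n, 0 ≤ f n)
    (h : ∀ φ : ℕ → ℕ, StrictMono φ → ∃ C, ∀ n, f (φ n) ≤ C * f n) :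
    BddAbove (Set.range f) := by
  suffices h' : ∃ n : ℕ, ∀ᶠ k in atTop, f k ≤ n * f n by
    obtain ⟨n, hn⟩ := h'
    exact (isBoundedUnder_of_eventually_le hn).bddAbove_range
  by_contra! h'
  obtain ⟨φ, hφ, hlt⟩ := extraction_forall_of_frequently h'
  obtain ⟨C, hC⟩ := h φ hφ
  obtain ⟨n, hn⟩ := exists_nat_ge C
  exact absurd ((hC n).trans (mul_le_mul_of_nonneg_right hn (hf n))) (hlt n).not_ge

namespace IsSpreading

variable {x : ℕ → E}

theorem comp (hx : IsSpreading 𝕜 x) {φ : ℕ → ℕ} (hφ : StrictMono φ) : IsSpreading 𝕜 (x ∘ φ) :=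
  fun θ hθ => ⟨(hx φ hφ).2.trans (hx (φ ∘ θ) (hφ.comp hθ)).1,
    (hx (φ ∘ θ) (hφ.comp hθ)).2.trans (hx φ hφ).1⟩

theorem sub_successive (hx : IsSpreading 𝕜 x) :
    IsSpreading 𝕜 fun k => x (2 * k) - x (2 * k + 1) := by
  intro θ hθ
  -- the pairs selected by `θ` form the subsequence `σ`
  let σ : ℕ → ℕ := fun n => 2 * θ (n / 2) + n % 2
  have hσ : StrictMono σ := strictMono_nat_of_lt_succ fun n => by
    obtain ⟨k, rfl | rfl⟩ : ∃ k, n = 2 * k ∨ n = 2 * k + 1 := ⟨n / 2, by omega⟩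
    · simp only [σ, show (2 * k + 1) / 2 = k by omega, show 2 * k / 2 = k by omega]
      omega
    · have := hθ (Nat.lt_add_one k)
      simp only [σ, show (2 * k + 1 + 1) / 2 = k + 1 by omega, show (2 * k + 1) / 2 = k by omega]
      omega
  let u : ℕ → ℕ →₀ 𝕜 := fun k => Finsupp.single (2 * k) 1 - Finsupp.single (2 * k + 1) 1
  have hu : ∀ (w : ℕ → E) k, Finsupp.linearCombination 𝕜 w (u k) = w (2 * k) - w (2 * k + 1) :=
    fun w k => by simp [u]
  have hσu : (fun k => Finsupp.linearCombination 𝕜 (x ∘ σ) (u k)) =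
      (fun k => x (2 * k) - x (2 * k + 1)) ∘ θ := by
    ext k
    simp [hu, σ, show (2 * k + 1) / 2 = k by omega, show (2 * k + 1) % 2 = 1 by omega]
  have h1 := (hx σ hσ).1.linearCombination u
  have h2 := (hx σ hσ).2.linearCombination u
  rw [hσu] at h1 h2
  simp only [hu] at h1 h2
  exact ⟨h1, h2⟩

theorem exists_forall_norm_le (hx : IsSpreading 𝕜 x) : ∃ B, ∀ n, ‖x n‖ ≤ B := by
  obtain ⟨B, hB⟩ := bddAbove_range_of_forall_subseq_le (fun n => norm_nonneg (x n)) fun φ hφ =>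
    let ⟨C, _, hC⟩ := (hx φ hφ).1.exists_norm_le
    ⟨C, hC⟩
  exact ⟨B, fun n => hB (Set.mem_range_self n)⟩

theorem exists_forall_le_norm (hx : IsSpreading 𝕜 x) (hx0 : ∀ n, x n ≠ 0) :
    ∃ δ, 0 < δ ∧ ∀ n, δ ≤ ‖x n‖ := by
  have hpos : ∀ n, 0 < ‖x n‖ := fun n => norm_pos_iff.2 (hx0 n)
  obtain ⟨B, hB⟩ := bddAbove_range_of_forall_subseq_le (fun n => (inv_pos.2 (hpos n)).le)
    fun φ hφ => by
      obtain ⟨C, -, hC⟩ := (hx φ hφ).2.exists_norm_le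
      refine ⟨C, fun n => ?_⟩
      rw [inv_le_iff_one_le_mul₀ (hpos _), mul_assoc, mul_comm, mul_assoc, mul_comm _ C,
        inv_mul_eq_div, one_le_div (hpos n)]
      exact hC n
  have hB' : ∀ n, ‖x n‖⁻¹ ≤ B := fun n => hB (Set.mem_range_self n)
  exact ⟨B⁻¹, inv_pos.2 ((inv_pos.2 (hpos 0)).trans_le (hB' 0)), fun n =>
    inv_le_of_inv_le₀ (hpos n) (hB' n)⟩

end IsSpreading

theorem IsUnconditionalBasicSequence.injective {x : ℕ → E}
    (hx : IsUnconditionalBasicSequence 𝕜 x) : Function.Injective x := by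
  classical
  intro m n hmn
  have hsum : ∀ k, HasSum (fun j => (Pi.single k 1 : ℕ → 𝕜) j • x j) (x k) := fun k => by
    simpa using hasSum_single (f := fun j => (Pi.single k 1 : ℕ → 𝕜) j • x j) k
      fun j hj => by simp [hj]
  have h := (hx (x m) (subset_closure (Submodule.subset_span ⟨m, rfl⟩))).unique (hsum m)
    (hmn ▸ hsum n)
  by_contra hne
  simpa [hne] using congrFun h m

theorem IsSubsymmetricBasicSequence.isSpreading [ContinuousConstSMul 𝕜 E]
    (hE : IsHomogeneousNorm 𝕜 E p) {x : ℕ → E} (hx : IsSubsymmetricBasicSequence 𝕜 x) :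
    IsSpreading 𝕜 x := by
  have dominates : ∀ {y z : ℕ → E} (T : closedSpan 𝕜 y →L[𝕜] closedSpan 𝕜 z),
      (∀ n, T ⟨y n, mem_closedSpan 𝕜 y n⟩ = ⟨z n, mem_closedSpan 𝕜 z n⟩) →
      Dominates 𝕜 y z := by
    intro y z T hT
    obtain ⟨C, hC, hTC⟩ := (hE.submodule _).exists_norm_le_of_continuous (hE.submodule _) T
    refine ⟨C, hC, fun a => ?_⟩
    have h := hTC (∑ n ∈ a.support, a n • ⟨y n, mem_closedSpan 𝕜 y n⟩)
    simpa only [map_sum, map_smul, hT, Submodule.coe_norm, Submodule.coe_sum, Submodule.coe_smul,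
      Finsupp.linearCombination_apply, Finsupp.sum] using h
  intro θ hθ
  obtain ⟨T, hT⟩ := hx.2 θ hθ
  exact ⟨dominates T.toContinuousLinearMap hT,
    dominates T.symm.toContinuousLinearMap fun n => T.symm_apply_eq.2 (hT n).symm⟩

end Domination

/-! ### Block sequences of a suppression unconditional basis -/

/-- A basis for which the projections onto finite sets of coordinates have norm at most `1`. -/
structure SuppressionBasis (𝕜 E : Type*) [RCLike 𝕜] [NormedAddCommGroup E] [Module 𝕜 E] where
  vec : ℕ → E
  /-- The coordinate functionals; their continuity follows from `norm_sum_le`. -/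
  coord : ℕ → E →ₗ[𝕜] 𝕜
  coord_vec : ∀ m n, coord m (vec n) = (Pi.single n 1 : ℕ → 𝕜) m
  norm_sum_le : ∀ (I : Finset ℕ) v, ‖∑ n ∈ I, coord n v • vec n‖ ≤ ‖v‖
  tendsto_sum : ∀ v, Tendsto (fun N => ∑ n ∈ Finset.range N, coord n v • vec n) atTop (𝓝 v)

namespace SuppressionBasis

variable {𝕜 : Type*} [RCLike 𝕜] {E : Type*} [NormedAddCommGroup E] [Module 𝕜 E] {p : ℝ}
  (b : SuppressionBasis 𝕜 E) {N : ℕ → ℕ} {z : ℕ → E}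

/-- The projection onto the span of the basis vectors with index in `I`. -/
def proj (I : Finset ℕ) : E →ₗ[𝕜] E := ∑ n ∈ I, (b.coord n).smulRight (b.vec n)

theorem proj_apply (I : Finset ℕ) (v : E) : b.proj I v = ∑ n ∈ I, b.coord n v • b.vec n := by
  simp [proj]

theorem norm_proj_le (I : Finset ℕ) (v : E) : ‖b.proj I v‖ ≤ ‖v‖ := by
  simpa only [proj_apply] using b.norm_sum_le I v

theorem coord_proj_of_mem {I : Finset ℕ} {n : ℕ} (hn : n ∈ I) (v : E) :
    b.coord n (b.proj I v) = b.coord n v := by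
  simp [proj_apply, coord_vec, Pi.single_apply, hn]

theorem coord_proj_of_notMem {I : Finset ℕ} {n : ℕ} (hn : n ∉ I) (v : E) :
    b.coord n (b.proj I v) = 0 := by
  simp [proj_apply, coord_vec, Pi.single_apply, hn]

theorem proj_proj_self (I : Finset ℕ) (v : E) : b.proj I (b.proj I v) = b.proj I v := by
  rw [proj_apply b I (b.proj I v), proj_apply]
  exact Finset.sum_congr rfl fun n hn => by rw [← proj_apply, b.coord_proj_of_mem hn]

theorem proj_proj_of_disjoint {I J : Finset ℕ} (h : Disjoint I J) (v : E) :
    b.proj I (b.proj J v) = 0 := by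
  rw [proj_apply]
  exact Finset.sum_eq_zero fun n hn => by
    rw [b.coord_proj_of_notMem (Finset.disjoint_left.1 h hn), zero_smul]

theorem vec_ne_zero (n : ℕ) : b.vec n ≠ 0 := fun h => by
  simpa [h] using b.coord_vec n n

theorem norm_coord_rpow_le (hE : IsHomogeneousNorm 𝕜 E p) (n : ℕ) (v : E) :
    ‖b.coord n v‖ ^ p ≤ ‖v‖ / ‖b.vec n‖ := by
  rw [le_div_iff₀ (norm_pos_iff.2 (b.vec_ne_zero n)), ← hE.norm_smul]
  simpa using b.norm_sum_le {n} v

/-- The vectors `z k` lie in the spans of the basis vectors with index in `[N k, N (k + 1))`. -/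
structure IsBlockSequence (N : ℕ → ℕ) (z : ℕ → E) : Prop where
  strictMono : StrictMono N
  proj_self : ∀ k, b.proj (Finset.Ico (N k) (N (k + 1))) (z k) = z k

namespace IsBlockSequence

variable {b}

theorem proj_of_ne (h : b.IsBlockSequence N z) {j k : ℕ} (hjk : j ≠ k) :
    b.proj (Finset.Ico (N k) (N (k + 1))) (z j) = 0 := by
  rw [← h.proj_self j]
  refine b.proj_proj_of_disjoint (Finset.disjoint_left.2 fun n hn hn' => ?_) _
  rw [Finset.mem_Ico] at hn hn'
  rcases hjk.lt_or_gt with hlt | hlt <;>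
  · have := h.strictMono.monotone (Nat.succ_le_of_lt hlt)
    simp only [Nat.succ_eq_add_one] at this
    omega

theorem proj_sum_smul (h : b.IsBlockSequence N z) {θ : ℕ → ℕ} (hθ : Function.Injective θ)
    {s : Finset ℕ} (a : ℕ → 𝕜) {k : ℕ} (hk : k ∈ s) :
    b.proj (Finset.Ico (N (θ k)) (N (θ k + 1))) (∑ j ∈ s, a j • z (θ j)) = a k • z (θ k) := by
  rw [map_sum, Finset.sum_eq_single_of_mem k hk fun j _ hj => ?_, map_smul, h.proj_self]
  rw [map_smul, h.proj_of_ne (hθ.ne hj), smul_zero]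

theorem norm_smul_le (h : b.IsBlockSequence N z) (a : ℕ →₀ 𝕜) (k : ℕ) :
    ‖a k • z k‖ ≤ ‖Finsupp.linearCombination 𝕜 z a‖ := by
  by_cases hk : k ∈ a.support
  · have hproj := h.proj_sum_smul Function.injective_id a hk
    simp only [id] at hproj
    rw [← hproj]
    exact b.norm_proj_le _ _
  · simp [Finsupp.notMem_support_iff.1 hk]

end IsBlockSequence

theorem exists_near_block (hE : IsHomogeneousNorm 𝕜 E p) {y : ℕ → E}
    (hy : ∀ n, Tendsto (fun k => b.coord n (y k)) atTop (𝓝 0)) {ε : ℝ} (hε : 0 < ε) (m n : ℕ) :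
    ∃ k > m, ∃ N > n, ‖y k - b.proj (Finset.Ico n N) (y k)‖ ≤ ε := by
  have head : Tendsto (fun k => b.proj (Finset.range n) (y k)) atTop (𝓝 0) := by
    simp only [proj_apply]
    rw [← Finset.sum_const_zero (s := Finset.range n)]
    exact tendsto_finsetSum _ fun i _ => hE.tendsto_smul_zero (hy i) _
  obtain ⟨k, hk, hmk⟩ := (((tendsto_zero_iff_norm_tendsto_zero.1 head).eventually
    (gt_mem_nhds (half_pos hε))).and (eventually_gt_atTop m)).exists
  obtain ⟨N, hN, hnN⟩ := (((tendsto_iff_norm_sub_tendsto_zero.1 (b.tendsto_sum (y k))).eventually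
    (gt_mem_nhds (half_pos hε))).and (eventually_gt_atTop n)).exists
  refine ⟨k, hmk, N, hnN, ?_⟩
  rw [← proj_apply] at hN
  have hIco : b.proj (Finset.Ico n N) (y k) =
      b.proj (Finset.range N) (y k) - b.proj (Finset.range n) (y k) := by
    simp only [proj_apply, Finset.sum_Ico_eq_sub _ hnN.le]
  calc ‖y k - b.proj (Finset.Ico n N) (y k)‖
      = ‖b.proj (Finset.range n) (y k) - (b.proj (Finset.range N) (y k) - y k)‖ := by
        rw [hIco]; congr 1; abel
    _ ≤ ‖b.proj (Finset.range n) (y k)‖ + ‖b.proj (Finset.range N) (y k) - y k‖ := norm_sub_le _ _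
    _ ≤ ε := by linarith

theorem exists_subseq_near_blocks (hE : IsHomogeneousNorm 𝕜 E p) {y : ℕ → E}
    (hy : ∀ n, Tendsto (fun k => b.coord n (y k)) atTop (𝓝 0)) {ε : ℕ → ℝ} (hε : ∀ k, 0 < ε k) :
    ∃ ψ N : ℕ → ℕ, StrictMono ψ ∧ StrictMono N ∧
      ∀ k, ‖y (ψ k) - b.proj (Finset.Ico (N k) (N (k + 1))) (y (ψ k))‖ ≤ ε k := by
  choose F hF G hG hFG using fun k => b.exists_near_block hE hy (hε k)
  obtain ⟨q, hq⟩ : ∃ q : ℕ → ℕ × ℕ,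
      ∀ k, q (k + 1) = (F k (q k).1 (q k).2, G k (q k).1 (q k).2) :=
    ⟨fun j => Nat.rec (0, 0) (fun k m => (F k m.1 m.2, G k m.1 m.2)) j, fun k => rfl⟩
  refine ⟨fun k => (q (k + 1)).1, fun k => (q k).2, strictMono_nat_of_lt_succ fun k => ?_,
    strictMono_nat_of_lt_succ fun k => ?_, fun k => ?_⟩
  · rw [hq (k + 1)]
    exact hF _ _ _
  · rw [hq k]
    exact hG _ _ _
  · simp only [hq k]
    exact hFG _ _ _

end SuppressionBasis

section Perturbation

variable {𝕜 : Type*} [RCLike 𝕜] {E : Type*} [NormedAddCommGroup E] [Module 𝕜 E] {p : ℝ}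
  {y z : ℕ → E}

theorem norm_linearCombination_sub_le (hE : IsHomogeneousNorm 𝕜 E p)
    (hz : ∀ (a : ℕ →₀ 𝕜) k, ‖a k • z k‖ ≤ ‖Finsupp.linearCombination 𝕜 z a‖)
    (hyz : ∀ k, ‖y k - z k‖ ≤ 1 / 4 * (1 / 2) ^ k * ‖z k‖) (a : ℕ →₀ 𝕜) :
    ‖Finsupp.linearCombination 𝕜 y a - Finsupp.linearCombination 𝕜 z a‖ ≤
      1 / 2 * ‖Finsupp.linearCombination 𝕜 z a‖ := by
  calc ‖Finsupp.linearCombination 𝕜 y a - Finsupp.linearCombination 𝕜 z a‖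
      = ‖∑ k ∈ a.support, a k • (y k - z k)‖ := by
        simp only [Finsupp.linearCombination_apply, Finsupp.sum, smul_sub, Finset.sum_sub_distrib]
    _ ≤ ∑ k ∈ a.support, ‖a k • (y k - z k)‖ := norm_sum_le _ _
    _ ≤ ∑ k ∈ a.support, 1 / 4 * ‖Finsupp.linearCombination 𝕜 z a‖ * (1 / 2) ^ k := by
        refine Finset.sum_le_sum fun k _ => ?_
        calc ‖a k • (y k - z k)‖ ≤ ‖a k‖ ^ p * (1 / 4 * (1 / 2) ^ k * ‖z k‖) := by
              rw [hE.norm_smul]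
              gcongr
              exact hyz k
          _ = 1 / 4 * ‖a k • z k‖ * (1 / 2) ^ k := by rw [hE.norm_smul]; ring
          _ ≤ _ := by gcongr; exact hz a k
    _ ≤ 1 / 4 * ‖Finsupp.linearCombination 𝕜 z a‖ * 2 := by
        rw [← Finset.mul_sum]
        gcongr
        exact (summable_geometric_two.sum_le_tsum _ fun _ _ => by positivity).trans_eq
          tsum_geometric_two
    _ = _ := by ring

theorem dominates_of_perturbation (hE : IsHomogeneousNorm 𝕜 E p)
    (hz : ∀ (a : ℕ →₀ 𝕜) k, ‖a k • z k‖ ≤ ‖Finsupp.linearCombination 𝕜 z a‖)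
    (hyz : ∀ k, ‖y k - z k‖ ≤ 1 / 4 * (1 / 2) ^ k * ‖z k‖) :
    Dominates 𝕜 y z ∧ Dominates 𝕜 z y := by
  have h := norm_linearCombination_sub_le hE hz hyz
  refine ⟨⟨2, two_pos, fun a => ?_⟩, ⟨3 / 2, by norm_num, fun a => ?_⟩⟩
  · linarith [h a, norm_sub_norm_le (Finsupp.linearCombination 𝕜 z a)
      (Finsupp.linearCombination 𝕜 y a), norm_sub_rev (Finsupp.linearCombination 𝕜 z a)
      (Finsupp.linearCombination 𝕜 y a)]
  · linarith [h a, norm_sub_norm_le (Finsupp.linearCombination 𝕜 y a)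
      (Finsupp.linearCombination 𝕜 z a)]

theorem IsSpreading.of_perturbation (hy : IsSpreading 𝕜 y) (hE : IsHomogeneousNorm 𝕜 E p)
    (hz : ∀ (a : ℕ →₀ 𝕜) k, ‖a k • z k‖ ≤ ‖Finsupp.linearCombination 𝕜 z a‖)
    (hyz : ∀ k, ‖y k - z k‖ ≤ 1 / 4 * (1 / 2) ^ k * ‖z k‖) : IsSpreading 𝕜 z := by
  intro θ hθ
  have hzθ : ∀ (a : ℕ →₀ 𝕜) k,
      ‖a k • z (θ k)‖ ≤ ‖Finsupp.linearCombination 𝕜 (z ∘ θ) a‖ := fun a k => by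
    have h := hz (a.mapDomain θ) (θ k)
    rwa [Finsupp.mapDomain_apply hθ.injective, Finsupp.linearCombination_mapDomain] at h
  have hyzθ : ∀ k, ‖y (θ k) - z (θ k)‖ ≤ 1 / 4 * (1 / 2) ^ k * ‖z (θ k)‖ := fun k =>
    (hyz (θ k)).trans (by
      gcongr 1 / 4 * ?_ * _
      exact pow_le_pow_of_le_one (by norm_num) (by norm_num) hθ.le_apply)
  obtain ⟨h1, h2⟩ := dominates_of_perturbation hE hz hyz
  obtain ⟨h3, h4⟩ := dominates_of_perturbation (y := y ∘ θ) (z := z ∘ θ) hE hzθ hyzθ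
  exact ⟨h2.trans ((hy θ hθ).1.trans h3), h4.trans ((hy θ hθ).2.trans h1)⟩

end Perturbation

section Subsymmetric

variable {𝕜 : Type*} [RCLike 𝕜] {E : Type*} [NormedAddCommGroup E] [Module 𝕜 E] {p : ℝ}

theorem exists_subseq_tendsto_coord {c : ℕ → ℕ → 𝕜} {b : ℕ → ℝ} (hb : ∀ n k, ‖c n k‖ ≤ b n) :
    ∃ φ : ℕ → ℕ, StrictMono φ ∧
      ∃ l : ℕ → 𝕜, ∀ n, Tendsto (fun k => c n (φ k)) atTop (𝓝 (l n)) := by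
  have hK : IsCompact (Set.univ.pi fun n => Metric.closedBall (0 : 𝕜) (b n)) :=
    isCompact_univ_pi fun n => isCompact_closedBall _ _
  obtain ⟨l, -, φ, hφ, hl⟩ := hK.tendsto_subseq (x := fun k n => c n k) fun k n _ => by
    simpa using hb n k
  exact ⟨φ, hφ, l, fun n => (tendsto_pi_nhds.1 hl) n⟩

theorem IsSpreading.exists_coord_sub_tendsto_zero {x : ℕ → E} (hx : IsSpreading 𝕜 x)
    (hE : IsHomogeneousNorm 𝕜 E p) (b : SuppressionBasis 𝕜 E) : ∃ φ : ℕ → ℕ, StrictMono φ ∧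
      ∀ n, Tendsto (fun k => b.coord n (x (φ (2 * k)) - x (φ (2 * k + 1)))) atTop (𝓝 0) := by
  obtain ⟨B, hB⟩ := hx.exists_forall_norm_le
  have hB0 : 0 ≤ B := (norm_nonneg _).trans (hB 0)
  obtain ⟨φ, hφ, l, hl⟩ := exists_subseq_tendsto_coord (c := fun n k => b.coord n (x k))
    (b := fun n => (B / ‖b.vec n‖) ^ p⁻¹) fun n k => by
      rw [Real.le_rpow_inv_iff_of_pos (norm_nonneg _) (by positivity) hE.pos]
      exact (b.norm_coord_rpow_le hE n _).trans (by gcongr; exact hB k)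
  refine ⟨φ, hφ, fun n => ?_⟩
  have heven : StrictMono fun k : ℕ => 2 * k := fun i j h => by dsimp only; omega
  have hodd : StrictMono fun k : ℕ => 2 * k + 1 := fun i j h => by dsimp only; omega
  simpa using ((hl n).comp heven.tendsto_atTop).sub ((hl n).comp hodd.tendsto_atTop)

theorem IsSubsymmetricBasicSequence.exists_spreading_blocks [ContinuousConstSMul 𝕜 E]
    (hE : IsHomogeneousNorm 𝕜 E p) (b : SuppressionBasis 𝕜 E) {x : ℕ → E}
    (hx : IsSubsymmetricBasicSequence 𝕜 x) :
    ∃ (N : ℕ → ℕ) (z : ℕ → E) (δ B : ℝ), b.IsBlockSequence N z ∧ IsSpreading 𝕜 z ∧ 0 < δ ∧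
      ∀ k, δ ≤ ‖z k‖ ∧ ‖z k‖ ≤ B := by
  have hspread := hx.isSpreading hE
  obtain ⟨φ, hφ, hnull⟩ := hspread.exists_coord_sub_tendsto_zero hE b
  let d : ℕ → E := fun k => x (φ (2 * k)) - x (φ (2 * k + 1))
  have hd : IsSpreading 𝕜 d := (hspread.comp hφ).sub_successive
  obtain ⟨B, hB⟩ := hd.exists_forall_norm_le
  obtain ⟨δ, hδ, hδd⟩ := hd.exists_forall_le_norm fun k => sub_ne_zero.2 <|
    hx.1.injective.ne (hφ.injective.ne (by omega))
  obtain ⟨ψ, N, hψ, hN, hnear⟩ := b.exists_subseq_near_blocks hE hnull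
    (ε := fun k => δ / 8 * (1 / 2) ^ k) fun k => by positivity
  let z : ℕ → E := fun k => b.proj (Finset.Ico (N k) (N (k + 1))) (d (ψ k))
  have hz : b.IsBlockSequence N z := ⟨hN, fun k => b.proj_proj_self _ _⟩
  have hδz : ∀ k, δ / 2 ≤ ‖z k‖ := fun k => by
    have hpow : (1 / 2 : ℝ) ^ k ≤ 1 := pow_le_one₀ (by norm_num) (by norm_num)
    have h1 := norm_sub_norm_le (d (ψ k)) (z k)
    have h2 : ‖d (ψ k) - z k‖ ≤ δ / 8 * (1 / 2) ^ k := hnear k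
    nlinarith [hδd (ψ k)]
  refine ⟨N, z, δ / 2, B, hz, (hd.comp hψ).of_perturbation hE hz.norm_smul_le fun k => ?_,
    half_pos hδ, fun k => ⟨hδz k, (b.norm_proj_le _ _).trans (hB _)⟩⟩
  calc ‖(d ∘ ψ) k - z k‖ ≤ δ / 8 * (1 / 2) ^ k := hnear k
    _ = 1 / 4 * (1 / 2) ^ k * (δ / 2) := by ring
    _ ≤ 1 / 4 * (1 / 2) ^ k * ‖z k‖ := by gcongr; exact hδz k

/-- The bound on `s.card` is the one which `sum_tsirelsonNorm_Ico_le` requires of the blocks with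
indices in `θ '' s`. -/
theorem exists_strictMono_card_le {ι : Type*} {P : ℕ → Finset ℕ → ι → Prop}
    (h : ∀ k K, ∃ s a, (∀ n ∈ s, K ≤ n) ∧ P k s a) :
    ∃ θ : ℕ → ℕ, StrictMono θ ∧ ∀ k, ∃ s a, P k s a ∧ ∀ n ∈ s, s.card ≤ θ n := by
  choose s a hs hP using h
  obtain ⟨N, hN⟩ : ∃ N : ℕ → ℕ, ∀ k, N (k + 1) = max ((s k (N k)).card) (N k + 1) :=
    ⟨fun j => Nat.rec 0 (fun k m => max ((s k m).card) (m + 1)) j, fun k => rfl⟩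
  have hNm : StrictMono N := strictMono_nat_of_lt_succ fun k => by rw [hN]; omega
  refine ⟨fun n => N (n + 1), fun m n hmn => hNm (Nat.succ_lt_succ hmn), fun k =>
    ⟨s k (N k), a k (N k), hP _ _, fun n hn => ?_⟩⟩
  calc (s k (N k)).card ≤ N (k + 1) := by rw [hN]; exact le_max_left _ _
    _ ≤ N (n + 1) := hNm.monotone (Nat.succ_le_succ (hNm.le_apply.trans (hs _ _ n hn)))

end Subsymmetric

/-! ### The unit vector basis of `T^(r)` -/

theorem convexifiedNorm_mono {𝕜 : Type*} [RCLike 𝕜] {r : ℝ} (hr : 0 < r) {x y : ℕ → 𝕜}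
    (h : ∀ n, ‖x n‖ₑ ≤ ‖y n‖ₑ) : convexifiedNorm r x ≤ convexifiedNorm r y :=
  ENNReal.rpow_le_rpow (tsirelsonNorm_mono fun n => ENNReal.rpow_le_rpow (h n) hr.le)
    (one_div_nonneg.2 hr.le)

namespace TsirelsonSpace

variable {𝕜 : Type*} [RCLike 𝕜] {r : ℝ} [hr : Fact (0 < r)]

theorem enorm_eq (x : TsirelsonSpace 𝕜 r) : ‖x‖ₑ = convexifiedNorm r (toSeq x) ^ min r 1 := by
  rw [← ofReal_norm, norm_def, ENNReal.toReal_rpow, ENNReal.ofReal_toReal]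
  exact ENNReal.rpow_ne_top_of_nonneg (lt_min hr.out one_pos).le (convexifiedNorm_toSeq_ne_top x)

theorem tsirelsonNorm_enorm_rpow (x : TsirelsonSpace 𝕜 r) :
    (tsirelsonNorm fun n => ‖toSeq x n‖ₑ ^ r) = ‖x‖ₑ ^ max r 1 := by
  rw [enorm_eq, ← ENNReal.rpow_mul, min_mul_max, mul_one, convexifiedNorm_rpow hr.out]

theorem norm_le_norm_of_forall_le {x y : TsirelsonSpace 𝕜 r}
    (h : ∀ n, ‖toSeq x n‖ ≤ ‖toSeq y n‖) : ‖x‖ ≤ ‖y‖ := by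
  rw [← enorm_le_iff_norm_le, enorm_eq, enorm_eq]
  exact ENNReal.rpow_le_rpow (convexifiedNorm_mono hr.out fun n =>
    enorm_le_iff_norm_le.2 (h n)) (lt_min hr.out one_pos).le

theorem isHomogeneousNorm : IsHomogeneousNorm 𝕜 (TsirelsonSpace 𝕜 r) (min r 1) :=
  ⟨lt_min hr.out one_pos, norm_smul_eq⟩

variable (𝕜 r) in
/-- The inclusion of the finitely supported sequences in `T^(r)`. -/
noncomputable def ofFinsupp : (ℕ →₀ 𝕜) →ₗ[𝕜] TsirelsonSpace 𝕜 r :=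
  LinearMap.codRestrict (tsirelsonSubmodule 𝕜 r) Finsupp.lcoeFun fun y _ hε =>
    ⟨y, by simpa [convexifiedNorm_zero hr.out] using hε⟩

theorem toSeq_ofFinsupp (y : ℕ →₀ 𝕜) : toSeq (ofFinsupp 𝕜 r y) = y := rfl

theorem exists_norm_sub_ofFinsupp_lt (x : TsirelsonSpace 𝕜 r) {ε : ℝ} (hε : 0 < ε) :
    ∃ y : ℕ →₀ 𝕜, ‖x - ofFinsupp 𝕜 r y‖ < ε := by
  have hp : 0 < min r 1 := lt_min hr.out one_pos
  obtain ⟨y, hy⟩ := x.2 (ENNReal.ofReal ε ^ (min r 1)⁻¹)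
    (ENNReal.rpow_pos_of_nonneg (ENNReal.ofReal_pos.2 hε) (inv_nonneg.2 hp.le))
  refine ⟨y, ?_⟩
  rw [← ENNReal.ofReal_lt_ofReal_iff hε, ofReal_norm, enorm_eq, map_sub, toSeq_ofFinsupp]
  exact (ENNReal.lt_rpow_inv_iff hp).1 hy

theorem toSeq_sum_smul_ofFinsupp_single (I : Finset ℕ) (a : ℕ → 𝕜) :
    toSeq (∑ n ∈ I, a n • ofFinsupp 𝕜 r (Finsupp.single n 1)) = (I : Set ℕ).indicator a := by
  ext m
  simp [toSeq_ofFinsupp, Finset.sum_apply, Finsupp.single_apply, Set.indicator]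

theorem tendsto_sum_toSeq_smul (x : TsirelsonSpace 𝕜 r) :
    Tendsto (fun N => ∑ n ∈ Finset.range N, toSeq x n • ofFinsupp 𝕜 r (Finsupp.single n 1))
      atTop (𝓝 x) := by
  rw [Metric.tendsto_atTop]
  intro ε hε
  obtain ⟨y, hy⟩ := exists_norm_sub_ofFinsupp_lt x hε
  obtain ⟨M, hM⟩ := y.support.exists_nat_subset_range
  refine ⟨M, fun N hN => ?_⟩
  rw [dist_comm, dist_eq_norm]
  refine lt_of_le_of_lt (norm_le_norm_of_forall_le fun n => ?_) hy
  rw [map_sub, map_sub, toSeq_sum_smul_ofFinsupp_single, toSeq_ofFinsupp]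
  by_cases hn : n < N
  · simp [hn]
  · have hyn : y n = 0 := Finsupp.notMem_support_iff.1 fun h =>
      hn ((Finset.mem_range.1 (hM h)).trans_le hN)
    simp [hn, hyn]

variable (𝕜 r) in
/-- The unit vectors of `T^(r)`. -/
noncomputable def unitBasis : SuppressionBasis 𝕜 (TsirelsonSpace 𝕜 r) where
  vec n := ofFinsupp 𝕜 r (Finsupp.single n 1)
  coord n := (LinearMap.proj n).comp toSeq
  coord_vec m n := by simp [toSeq_ofFinsupp, Finsupp.single_eq_pi_single]
  norm_sum_le I x := norm_le_norm_of_forall_le fun n =>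
    (congrArg norm (congrFun (toSeq_sum_smul_ofFinsupp_single I (toSeq x)) n)).trans_le
      (norm_indicator_le_norm_self _ n)
  tendsto_sum x := by simpa using tendsto_sum_toSeq_smul x

theorem coord_unitBasis (n : ℕ) (x : TsirelsonSpace 𝕜 r) :
    (unitBasis 𝕜 r).coord n x = toSeq x n := rfl

theorem toSeq_proj_unitBasis (I : Finset ℕ) (x : TsirelsonSpace 𝕜 r) :
    toSeq ((unitBasis 𝕜 r).proj I x) = (I : Set ℕ).indicator (toSeq x) := by
  rw [SuppressionBasis.proj_apply]
  exact toSeq_sum_smul_ofFinsupp_single I (toSeq x)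

theorem tsirelsonNorm_indicator_enorm_rpow (I : Finset ℕ) (x : TsirelsonSpace 𝕜 r) :
    tsirelsonNorm ((I : Set ℕ).indicator fun n => ‖toSeq x n‖ₑ ^ r) =
      ‖(unitBasis 𝕜 r).proj I x‖ₑ ^ max r 1 := by
  rw [← tsirelsonNorm_enorm_rpow, toSeq_proj_unitBasis]
  congr 1
  ext n
  by_cases hn : n ∈ I <;> simp [hn, hr.out]

theorem sum_norm_proj_rpow_le {N θ : ℕ → ℕ} (hN : StrictMono N) (hθ : StrictMono θ)
    {s : Finset ℕ} (hs : ∀ k ∈ s, s.card ≤ θ k) (x : TsirelsonSpace 𝕜 r) :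
    (∑ k ∈ s, ‖(unitBasis 𝕜 r).proj (Finset.Ico (N (θ k)) (N (θ k + 1))) x‖ ^ max r 1) / 2 ≤
      ‖x‖ ^ max r 1 := by
  have h := sum_tsirelsonNorm_Ico_le hN hθ hs fun n => ‖toSeq x n‖ₑ ^ r
  simp only [← Finset.coe_Ico, tsirelsonNorm_indicator_enorm_rpow, tsirelsonNorm_enorm_rpow] at h
  have henorm : ∀ v : TsirelsonSpace 𝕜 r, ‖v‖ₑ ^ max r 1 = ENNReal.ofReal (‖v‖ ^ max r 1) :=
    fun v => by rw [← ofReal_norm, ENNReal.ofReal_rpow_of_nonneg (norm_nonneg _) (by positivity)]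
  simp only [henorm] at h
  rw [← ENNReal.ofReal_sum_of_nonneg fun k _ => by positivity, ← ENNReal.ofReal_ofNat 2,
    ← ENNReal.ofReal_div_of_pos two_pos] at h
  exact (ENNReal.ofReal_le_ofReal_iff (by positivity)).1 h

end TsirelsonSpace

/-! ### Block sequences of `T^(r)` -/

namespace TsirelsonSpace

variable {𝕜 : Type*} [RCLike 𝕜] {r : ℝ} [hr : Fact (0 < r)] {N : ℕ → ℕ}
  {z : ℕ → TsirelsonSpace 𝕜 r}

theorem support_subset_of_isBlockSequence (hz : (unitBasis 𝕜 r).IsBlockSequence N z) (k : ℕ) :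
    Function.support (toSeq (z k)) ⊆ Set.Ico (N k) (N (k + 1)) := by
  rw [← hz.proj_self k, toSeq_proj_unitBasis, Finset.coe_Ico]
  exact Set.support_indicator_subset

theorem enorm_toSeq_sum_rpow_le (hz : (unitBasis 𝕜 r).IsBlockSequence N z) (s : Finset ℕ)
    (a : ℕ → 𝕜) (n : ℕ) : ‖toSeq (∑ k ∈ s, a k • z k) n‖ₑ ^ r ≤
      ∑ k ∈ s, ‖a k‖ₑ ^ r * ‖toSeq (z k) n‖ₑ ^ r := by
  by_cases hn : ∃ k ∈ s, n ∈ Finset.Ico (N k) (N (k + 1))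
  · obtain ⟨k, hk, hnk⟩ := hn
    have hproj := hz.proj_sum_smul Function.injective_id a hk
    simp only [id] at hproj
    rw [← coord_unitBasis, ← (unitBasis 𝕜 r).coord_proj_of_mem hnk, hproj, map_smul, enorm_smul,
      coord_unitBasis, ENNReal.mul_rpow_of_nonneg _ _ hr.out.le]
    exact Finset.single_le_sum (f := fun k => ‖a k‖ₑ ^ r * ‖toSeq (z k) n‖ₑ ^ r)
      (fun _ _ => zero_le) hk
  · have hzero : ∀ k ∈ s, toSeq (z k) n = 0 := fun k hk => by
      by_contra h
      exact hn ⟨k, hk, Finset.mem_Ico.2 (support_subset_of_isBlockSequence hz k h)⟩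
    rw [map_sum, Finset.sum_apply, Finset.sum_eq_zero fun k hk => by simp [hzero k hk]]
    simp [hr.out]

theorem exists_norm_sum_lt (hz : (unitBasis 𝕜 r).IsBlockSequence N z) {B : ℝ}
    (hB : ∀ k, ‖z k‖ ≤ B) (K : ℕ) {c : ℝ} (hc : 0 < c) :
    ∃ (s : Finset ℕ) (a : ℕ → ℝ≥0), (∀ k ∈ s, K ≤ k) ∧ ∑ k ∈ s, a k ^ r = 1 ∧
      ‖∑ k ∈ s, ((a k : ℝ) : 𝕜) • z k‖ < c := by
  have hq : 0 < max r 1 := lt_max_of_lt_right one_pos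
  have hzB : ∀ k, (tsirelsonNorm fun n => ‖toSeq (z k) n‖ₑ ^ r) ≤ ENNReal.ofReal B ^ max r 1 :=
    fun k => by
      rw [tsirelsonNorm_enorm_rpow, ← ofReal_norm]
      exact ENNReal.rpow_le_rpow (ENNReal.ofReal_le_ofReal (hB k)) hq.le
  have hsupp : ∀ k, (Function.support fun n => ‖toSeq (z k) n‖ₑ ^ r) ⊆
      Set.Ico (N k) (N (k + 1)) := fun k n hn =>
    support_subset_of_isBlockSequence hz k fun h => hn (by simp [h, hr.out])
  obtain ⟨s, α, hsK, hα, hlt⟩ := exists_convex_combination_tsirelsonNorm_lt hz.strictMono hsupp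
    (ENNReal.rpow_ne_top_of_nonneg hq.le ENNReal.ofReal_ne_top) hzB K
    (ENNReal.rpow_pos_of_nonneg (ENNReal.ofReal_pos.2 hc) hq.le)
  have hαr : ∀ k, (α k ^ r⁻¹) ^ r = α k := fun k => NNReal.rpow_inv_rpow hr.out.ne' _
  have hcoef : ∀ k, ‖(((α k ^ r⁻¹ : ℝ≥0) : ℝ) : 𝕜)‖ₑ ^ r = α k := fun k => by
    rw [← ofReal_norm, RCLike.norm_ofReal, NNReal.abs_eq, ENNReal.ofReal_coe_nnreal,
      ← ENNReal.coe_rpow_of_nonneg _ hr.out.le, hαr]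
  refine ⟨s, fun k => α k ^ r⁻¹, hsK, by simpa only [hαr] using hα, ?_⟩
  rw [← ENNReal.ofReal_lt_ofReal_iff hc, ofReal_norm, ← ENNReal.rpow_lt_rpow_iff hq,
    ← tsirelsonNorm_enorm_rpow]
  refine (tsirelsonNorm_mono fun n => (enorm_toSeq_sum_rpow_le hz s _ n).trans_eq ?_).trans_lt hlt
  simp only [Finset.sum_apply, Pi.smul_apply, ENNReal.smul_def, smul_eq_mul, hcoef]

theorem le_norm_sum_rpow (hz : (unitBasis 𝕜 r).IsBlockSequence N z) {δ : ℝ} (hδ : 0 ≤ δ)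
    (hδz : ∀ k, δ ≤ ‖z k‖) {θ : ℕ → ℕ} (hθ : StrictMono θ) {s : Finset ℕ}
    (hs : ∀ k ∈ s, s.card ≤ θ k) (a : ℕ → 𝕜) :
    (∑ k ∈ s, ‖a k‖ ^ r) * δ ^ max r 1 / 2 ≤ ‖∑ k ∈ s, a k • z (θ k)‖ ^ max r 1 := by
  refine le_trans ?_ (sum_norm_proj_rpow_le hz.strictMono hθ hs _)
  rw [Finset.sum_mul]
  gcongr with k hk
  rw [hz.proj_sum_smul hθ.injective a hk, norm_smul_eq,
    Real.mul_rpow (by positivity) (norm_nonneg _), ← Real.rpow_mul (norm_nonneg _), min_mul_max,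
    mul_one]
  gcongr
  exact hδz _

theorem not_isSubsymmetricBasicSequence (x : ℕ → TsirelsonSpace 𝕜 r) :
    ¬ IsSubsymmetricBasicSequence 𝕜 x := by
  intro hx
  obtain ⟨N, z, δ, B, hz, hspread, hδ, hzδB⟩ :=
    hx.exists_spreading_blocks isHomogeneousNorm (unitBasis 𝕜 r)
  obtain ⟨θ, hθ, hsmall⟩ := exists_strictMono_card_le
    (P := fun k s (a : ℕ → ℝ≥0) => ∑ n ∈ s, a n ^ r = 1 ∧
      ‖∑ n ∈ s, ((a n : ℝ) : 𝕜) • z n‖ < 1 / (k + 1)) fun k K =>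
        exists_norm_sum_lt hz (fun k => (hzδB k).2) K (by positivity)
  obtain ⟨C, hC, hCz⟩ := (hspread θ hθ).1.exists_norm_sum_le
  let c : ℝ := (δ ^ max r 1 / 2) ^ (max r 1)⁻¹
  obtain ⟨k, hk⟩ := exists_nat_one_div_lt (show 0 < c / C by positivity)
  obtain ⟨s, a, ⟨ha, hlt⟩, hs⟩ := hsmall k
  have ha' : ∑ n ∈ s, ‖((a n : ℝ) : 𝕜)‖ ^ r = 1 := by
    simpa using congrArg NNReal.toReal ha
  have hlow : c ≤ ‖∑ n ∈ s, ((a n : ℝ) : 𝕜) • z (θ n)‖ := by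
    rw [Real.rpow_inv_le_iff_of_pos (by positivity) (norm_nonneg _) (by positivity)]
    simpa only [ha', one_mul] using
      le_norm_sum_rpow hz hδ.le (fun k => (hzδB k).1) hθ hs fun n => ((a n : ℝ) : 𝕜)
  exact (hlow.trans (hCz s _)).not_gt ((lt_div_iff₀' hC).1 (hlt.trans hk))

end TsirelsonSpace

/-! ### Shrinking bases and the dual basis -/

namespace SuppressionBasis

variable {𝕜 : Type*} [RCLike 𝕜] {E : Type*} [NormedAddCommGroup E] [NormedSpace 𝕜 E]
  (b : SuppressionBasis 𝕜 E)

/-- The projection `SuppressionBasis.proj` as a continuous linear map. -/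
noncomputable def projL (I : Finset ℕ) : E →L[𝕜] E :=
  (b.proj I).mkContinuous 1 fun v => by simpa using b.norm_proj_le I v

/-- The coordinate functional `SuppressionBasis.coord` as an element of the dual space. -/
noncomputable def coordL (n : ℕ) : StrongDual 𝕜 E :=
  (b.coord n).mkContinuous ‖b.vec n‖⁻¹ fun v => by
    rw [inv_mul_eq_div, le_div_iff₀ (norm_pos_iff.2 (b.vec_ne_zero n)), ← norm_smul]
    simpa using b.norm_sum_le {n} v

theorem projL_apply (I : Finset ℕ) (v : E) : b.projL I v = b.proj I v := rfl

theorem norm_projL_le (I : Finset ℕ) : ‖b.projL I‖ ≤ 1 :=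
  LinearMap.mkContinuous_norm_le _ zero_le_one _

theorem sum_smul_coordL (f : StrongDual 𝕜 E) (I : Finset ℕ) :
    ∑ n ∈ I, f (b.vec n) • b.coordL n = f ∘L b.projL I := by
  ext v
  simp [projL_apply, proj_apply, coordL, mul_comm]

/-- The basis is shrinking: each continuous functional is small on the vectors whose coordinates
vanish on a long initial segment. -/
def IsShrinking : Prop :=
  ∀ (f : StrongDual 𝕜 E) (δ : ℝ), 0 < δ →
    ∀ᶠ N in atTop, ∀ M v, ‖f (b.proj (Finset.Ico N M) v)‖ ≤ δ * ‖v‖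

variable {b}

theorem IsShrinking.tendsto_comp_projL (hb : b.IsShrinking) (f : StrongDual 𝕜 E) :
    Tendsto (fun N => f ∘L b.projL (Finset.range N)) atTop (𝓝 f) := by
  rw [Metric.tendsto_atTop]
  intro ε hε
  obtain ⟨N₀, hN₀⟩ := eventually_atTop.1 (hb f (ε / 2) (half_pos hε))
  refine ⟨N₀, fun N hN => ?_⟩
  rw [dist_comm, dist_eq_norm]
  refine (ContinuousLinearMap.opNorm_le_bound _ (half_pos hε).le fun v => ?_).trans_lt
    (half_lt_self hε)
  have hlim : Tendsto (fun M => ‖f (b.proj (Finset.range M) v) - f (b.proj (Finset.range N) v)‖)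
      atTop (𝓝 ‖f v - f (b.proj (Finset.range N) v)‖) := by
    simp only [proj_apply b (Finset.range _) v]
    exact (((f.continuous.tendsto _).comp (b.tendsto_sum v)).sub_const _).norm
  refine le_of_tendsto hlim ?_
  filter_upwards [eventually_ge_atTop N] with M hM
  rw [← map_sub, proj_apply, proj_apply, ← Finset.sum_Ico_eq_sub _ hM, ← proj_apply]
  exact hN₀ N hN M v

/-- The coordinate functionals of a shrinking basis, as a basis of the dual space. -/
noncomputable def dual (hb : b.IsShrinking) : SuppressionBasis 𝕜 (StrongDual 𝕜 E) where
  vec := b.coordL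
  coord n := (ContinuousLinearMap.apply 𝕜 𝕜 (b.vec n)).toLinearMap
  coord_vec m n := by
    simpa [coordL, Pi.single_apply, eq_comm] using b.coord_vec n m
  norm_sum_le I f := by
    simpa [sum_smul_coordL] using (f.opNorm_comp_le (b.projL I)).trans
      (mul_le_of_le_one_right (norm_nonneg f) (b.norm_projL_le I))
  tendsto_sum f := by
    simpa [sum_smul_coordL] using hb.tendsto_comp_projL f

theorem dual_proj (hb : b.IsShrinking) (I : Finset ℕ) (f : StrongDual 𝕜 E) :
    (dual hb).proj I f = f ∘L b.projL I :=
  ((dual hb).proj_apply I f).trans (b.sum_smul_coordL f I)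

variable {hb : b.IsShrinking} {N : ℕ → ℕ} {g : ℕ → StrongDual 𝕜 E} {u : ℕ → E}

theorem IsBlockSequence.apply_proj (hg : (dual hb).IsBlockSequence N g) (k : ℕ) (v : E) :
    g k (b.proj (Finset.Ico (N k) (N (k + 1))) v) = g k v := by
  conv_rhs => rw [← hg.proj_self k, dual_proj]
  rfl

theorem IsBlockSequence.sum_smul_apply_sum_smul (hg : (dual hb).IsBlockSequence N g)
    (hu : b.IsBlockSequence N u) (s : Finset ℕ) (c a : ℕ → 𝕜) :
    (∑ k ∈ s, c k • g k) (∑ k ∈ s, a k • u k) = ∑ k ∈ s, c k * a k * g k (u k) := by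
  rw [sum_apply]
  refine Finset.sum_congr rfl fun k hk => ?_
  have hproj := hu.proj_sum_smul Function.injective_id a hk
  simp only [id] at hproj
  rw [smul_apply, ← hg.apply_proj, hproj, map_smul, smul_eq_mul, smul_eq_mul, mul_assoc]

theorem exists_apply_eq_ofReal {f : StrongDual 𝕜 E} {I : Finset ℕ} {v : E} {δ : ℝ}
    (hv : δ * ‖v‖ < ‖f (b.proj I v)‖) :
    ∃ u, b.proj I u = u ∧ ‖u‖ ≤ 1 ∧ ∃ t : ℝ, δ ≤ t ∧ f u = t := by
  have hv0 : 0 < ‖v‖ := norm_pos_iff.2 fun h => by simp [h] at hv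
  obtain ⟨c, hc, hcf⟩ := RCLike.exists_norm_eq_mul_self (f (b.proj I v))
  refine ⟨(((‖v‖⁻¹ : ℝ) : 𝕜) * c) • b.proj I v, by rw [map_smul, proj_proj_self], ?_,
    ‖v‖⁻¹ * ‖f (b.proj I v)‖, ?_, ?_⟩
  · rw [norm_smul, norm_mul, hc, mul_one, RCLike.norm_ofReal, abs_of_nonneg (by positivity),
      inv_mul_le_one₀ hv0]
    exact b.norm_proj_le I v
  · rw [inv_mul_eq_div, le_div_iff₀ hv0]
    exact hv.le
  · rw [map_smul, smul_eq_mul, mul_assoc, ← hcf, RCLike.ofReal_mul]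

end SuppressionBasis

/-! ### The dual of `T^(r)` -/

theorem sum_rpow_sub_one_mul_le {ι : Type*} {s : Finset ι} {r c : ℝ} (hr : 1 ≤ r) (hc : 0 < c)
    {a τ : ι → ℝ} (ha0 : ∀ i, 0 ≤ a i) (hτ0 : ∀ i, 0 ≤ τ i) (ha : ∑ i ∈ s, a i ^ r ≤ 1)
    (hτ : ∑ i ∈ s, τ i ^ r ≤ c ^ r) : ∑ i ∈ s, a i ^ (r - 1) * τ i ≤ c := by
  have hr0 : 0 < r := one_pos.trans_le hr
  have hw : 0 ≤ 1 - 1 / r := by rw [sub_nonneg, div_le_one hr0]; exact hr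
  have young : ∀ i, a i ^ (r - 1) * (τ i / c) ≤
      (1 - 1 / r) * a i ^ r + 1 / r * (τ i ^ r / c ^ r) := fun i => by
    have hτc : 0 ≤ τ i / c := div_nonneg (hτ0 i) hc.le
    have h := Real.geom_mean_le_arith_mean2_weighted hw (one_div_nonneg.2 hr0.le)
      (Real.rpow_nonneg (ha0 i) r) (Real.rpow_nonneg hτc r) (by ring)
    rwa [← Real.rpow_mul (ha0 i), ← Real.rpow_mul hτc, mul_one_div_cancel hr0.ne', Real.rpow_one,
      mul_sub, mul_one_div_cancel hr0.ne', mul_one, Real.div_rpow (hτ0 i) hc.le] at h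
  have hτ1 : ∑ i ∈ s, τ i ^ r / c ^ r ≤ 1 := by
    rwa [← Finset.sum_div, div_le_one (by positivity)]
  have hsum : ∑ i ∈ s, a i ^ (r - 1) * (τ i / c) ≤ 1 :=
    calc ∑ i ∈ s, a i ^ (r - 1) * (τ i / c)
        ≤ (1 - 1 / r) * ∑ i ∈ s, a i ^ r + 1 / r * ∑ i ∈ s, τ i ^ r / c ^ r := by
          rw [Finset.mul_sum, Finset.mul_sum, ← Finset.sum_add_distrib]
          exact Finset.sum_le_sum fun i _ => young i
      _ ≤ (1 - 1 / r) * 1 + 1 / r * 1 := by gcongr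
      _ = 1 := by ring
  simp only [← mul_div_assoc, ← Finset.sum_div] at hsum
  exact (div_le_one hc).1 hsum

namespace TsirelsonSpace

variable {𝕜 : Type*} [RCLike 𝕜] {r : ℝ} [h : Fact (1 ≤ r)]

theorem convex_setOf_enorm_rpow_le (f : TsirelsonSpace 𝕜 r →ₗ[𝕜] 𝕜) (δ : ℝ) :
    Convex ℝ≥0 {w : ℕ → ℝ≥0∞ | ∃ x : TsirelsonSpace 𝕜 r,
      (fun n => ‖toSeq x n‖ₑ ^ r) ≤ w ∧ δ ≤ RCLike.re (f x)} := by
  rintro w ⟨x, hxw, hfx⟩ w' ⟨x', hxw', hfx'⟩ α β - - hαβ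
  refine ⟨((α : ℝ) : 𝕜) • x + ((β : ℝ) : 𝕜) • x', fun n => ?_, ?_⟩
  · have henorm : ∀ (γ : ℝ≥0) (y : TsirelsonSpace 𝕜 r),
        ‖((γ : ℝ) : 𝕜) • toSeq y n‖ₑ = γ * ‖toSeq y n‖ₑ := fun γ y => by
      rw [enorm_smul, ← ofReal_norm, RCLike.norm_ofReal, NNReal.abs_eq, ENNReal.ofReal_coe_nnreal]
    calc ‖toSeq (((α : ℝ) : 𝕜) • x + ((β : ℝ) : 𝕜) • x') n‖ₑ ^ r
        ≤ (α * ‖toSeq x n‖ₑ + β * ‖toSeq x' n‖ₑ) ^ r := by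
          rw [map_add, map_smul, map_smul, Pi.add_apply, Pi.smul_apply, Pi.smul_apply, ← henorm,
            ← henorm]
          exact ENNReal.rpow_le_rpow (enorm_add_le _ _) (zero_le_one.trans h.out)
      _ ≤ α * ‖toSeq x n‖ₑ ^ r + β * ‖toSeq x' n‖ₑ ^ r :=
          ENNReal.rpow_arith_mean_le_arith_mean2_rpow _ _ _ _ (by exact_mod_cast hαβ) h.out
      _ ≤ (α • w + β • w') n := by
          simp only [Pi.add_apply, Pi.smul_apply, ENNReal.smul_def, smul_eq_mul]
          gcongr
          exacts [hxw n, hxw' n]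
  · have hαβ' : (α : ℝ) + β = 1 := by exact_mod_cast hαβ
    calc δ = α * δ + β * δ := by rw [← add_mul, hαβ', one_mul]
      _ ≤ α * RCLike.re (f x) + β * RCLike.re (f x') := by gcongr
      _ = _ := by simp

theorem exists_norm_lt_of_forall_exists_re_ge (f : TsirelsonSpace 𝕜 r →ₗ[𝕜] 𝕜) {δ : ℝ}
    (hf : ∀ K, ∃ N ≥ K, ∃ M u, (unitBasis 𝕜 r).proj (Finset.Ico N M) u = u ∧ ‖u‖ ≤ 1 ∧
      δ ≤ RCLike.re (f u)) {c : ℝ} (hc : 0 < c) : ∃ x, ‖x‖ < c ∧ δ ≤ RCLike.re (f x) := by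
  have hr : 0 < r := one_pos.trans_le h.out
  have hnorm : ∀ x : TsirelsonSpace 𝕜 r, (tsirelsonNorm fun n => ‖toSeq x n‖ₑ ^ r) = ‖x‖ₑ ^ r :=
    fun x => by rw [tsirelsonNorm_enorm_rpow, max_eq_left h.out]
  have hfar : HasFarElements {w : ℕ → ℝ≥0∞ | ∃ x : TsirelsonSpace 𝕜 r,
      (fun n => ‖toSeq x n‖ₑ ^ r) ≤ w ∧ δ ≤ RCLike.re (f x)} 1 := fun K => by
    obtain ⟨N, hKN, M, u, hproj, hu, hfu⟩ := hf K
    refine ⟨fun n => ‖toSeq u n‖ₑ ^ r, ⟨u, le_rfl, hfu⟩, ⟨M, fun n hn => ?_⟩, ?_⟩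
    · have hun : toSeq u n ≠ 0 := fun h0 => hn (by simp [h0, hr])
      rw [← hproj, toSeq_proj_unitBasis, Finset.coe_Ico] at hun
      exact Set.Ico_subset_Ico_left hKN (Set.mem_of_indicator_ne_zero hun)
    · rw [hnorm, ← ofReal_norm]
      exact ENNReal.rpow_le_one (ENNReal.ofReal_le_one.2 hu) hr.le
  obtain ⟨w, ⟨x, hxw, hfx⟩, hw⟩ := hfar.exists_tsirelsonNorm_lt ENNReal.one_ne_top
    (convex_setOf_enorm_rpow_le f δ) (ENNReal.rpow_pos_of_nonneg (ENNReal.ofReal_pos.2 hc) hr.le)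
  refine ⟨x, ?_, hfx⟩
  have hx := (tsirelsonNorm_mono hxw).trans_lt hw
  rwa [hnorm, ENNReal.rpow_lt_rpow_iff hr, ← ofReal_norm, ENNReal.ofReal_lt_ofReal_iff hc] at hx

variable (𝕜 r) in
theorem isShrinking_unitBasis : (unitBasis 𝕜 r).IsShrinking := by
  intro f δ hδ
  by_contra hf
  have hfar : ∀ K, ∃ N ≥ K, ∃ M u, (unitBasis 𝕜 r).proj (Finset.Ico N M) u = u ∧ ‖u‖ ≤ 1 ∧
      δ ≤ RCLike.re (f u) := fun K => by
    obtain ⟨N, hN, hfN⟩ := frequently_atTop.1 (not_eventually.1 hf) K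
    push Not at hfN
    obtain ⟨M, v, hv⟩ := hfN
    obtain ⟨u, hproj, hu, t, hδt, hfu⟩ := SuppressionBasis.exists_apply_eq_ofReal hv
    exact ⟨N, hN, M, u, hproj, hu, by rwa [hfu, RCLike.ofReal_re]⟩
  obtain ⟨c, hc, hfc⟩ := Metric.continuous_iff.1 f.continuous 0 δ hδ
  obtain ⟨x, hx, hδx⟩ := exists_norm_lt_of_forall_exists_re_ge f.toLinearMap hfar hc
  have hfx := hfc x (by rwa [dist_zero_right])
  rw [map_zero, dist_zero_right] at hfx
  exact (hδx.trans (RCLike.re_le_norm _)).not_gt hfx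

variable (𝕜 r) in
/-- The coordinate functionals of `T^(r)`, as a basis of the dual space. -/
noncomputable def dualBasis : SuppressionBasis 𝕜 (StrongDual 𝕜 (TsirelsonSpace 𝕜 r)) :=
  SuppressionBasis.dual (isShrinking_unitBasis 𝕜 r)

variable {N : ℕ → ℕ} {g : ℕ → StrongDual 𝕜 (TsirelsonSpace 𝕜 r)}

theorem norm_sum_smul_dual_le (hg : (dualBasis 𝕜 r).IsBlockSequence N g)
    {B : ℝ} (hB : ∀ k, ‖g k‖ ≤ B) {θ : ℕ → ℕ} (hθ : StrictMono θ) {s : Finset ℕ}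
    (hs : ∀ k ∈ s, s.card ≤ θ k) {a : ℕ → ℝ≥0} (ha : ∑ k ∈ s, a k ^ r = 1) :
    ‖∑ k ∈ s, ((a k ^ (r - 1) : ℝ) : 𝕜) • g (θ k)‖ ≤ 2 * B := by
  have hB0 : 0 ≤ B := (norm_nonneg _).trans (hB 0)
  refine ContinuousLinearMap.opNorm_le_bound _ (by positivity) fun x => ?_
  rcases eq_or_ne x 0 with rfl | hx
  · simp
  let R : ℕ → ℝ := fun k => ‖(unitBasis 𝕜 r).proj (Finset.Ico (N (θ k)) (N (θ k + 1))) x‖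
  have hR : ∑ k ∈ s, R k ^ r ≤ (2 * ‖x‖) ^ r := by
    have hlow := sum_norm_proj_rpow_le hg.strictMono hθ hs x
    rw [max_eq_left h.out, div_le_iff₀' two_pos] at hlow
    rw [Real.mul_rpow zero_le_two (norm_nonneg x)]
    refine hlow.trans ?_
    gcongr
    simpa using Real.rpow_le_rpow_of_exponent_le one_le_two h.out
  have holder : ∑ k ∈ s, (a k : ℝ) ^ (r - 1) * R k ≤ 2 * ‖x‖ :=
    sum_rpow_sub_one_mul_le h.out (by positivity) (fun k => NNReal.zero_le_coe)
      (fun k => norm_nonneg _) (by exact_mod_cast ha.le) hR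
  calc ‖(∑ k ∈ s, ((a k ^ (r - 1) : ℝ) : 𝕜) • g (θ k)) x‖
      = ‖∑ k ∈ s, ((a k ^ (r - 1) : ℝ) : 𝕜) * g (θ k) x‖ := by simp [sum_apply]
    _ ≤ ∑ k ∈ s, (a k : ℝ) ^ (r - 1) * R k * B := norm_sum_le_of_le _ fun k _ => by
        rw [norm_mul, RCLike.norm_ofReal, abs_of_nonneg (by positivity), mul_assoc,
          ← hg.apply_proj, mul_comm (R k)]
        gcongr
        exact (g (θ k)).le_of_opNorm_le (hB _) _
    _ ≤ 2 * ‖x‖ * B := by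
        rw [← Finset.sum_mul]
        gcongr
    _ = 2 * B * ‖x‖ := by ring

theorem exists_norming_isBlockSequence (hg : (dualBasis 𝕜 r).IsBlockSequence N g)
    {δ : ℝ} (hδ : 0 ≤ δ) (hδg : ∀ k, δ < ‖g k‖) :
    ∃ (u : ℕ → TsirelsonSpace 𝕜 r) (t : ℕ → ℝ),
      (unitBasis 𝕜 r).IsBlockSequence N u ∧ ∀ k, ‖u k‖ ≤ 1 ∧ δ ≤ t k ∧ g k (u k) = t k := by
  have hu : ∀ k, ∃ u, (unitBasis 𝕜 r).proj (Finset.Ico (N k) (N (k + 1))) u = u ∧ ‖u‖ ≤ 1 ∧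
      ∃ t : ℝ, δ ≤ t ∧ g k u = t := fun k => by
    obtain ⟨v, hv⟩ := (g k).exists_mul_lt_of_lt_opNorm hδ (hδg k)
    exact SuppressionBasis.exists_apply_eq_ofReal (by rwa [hg.apply_proj])
  choose u hproj hu1 t ht hgu using hu
  exact ⟨u, t, ⟨hg.strictMono, hproj⟩, fun k => ⟨hu1 k, ht k, hgu k⟩⟩

theorem exists_lt_norm_sum_smul_dual (hg : (dualBasis 𝕜 r).IsBlockSequence N g)
    {δ : ℝ} (hδ : 0 < δ) (hδg : ∀ k, δ ≤ ‖g k‖) (K : ℕ) {c : ℝ} (hc : 0 < c) :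
    ∃ (s : Finset ℕ) (a : ℕ → ℝ≥0), (∀ k ∈ s, K ≤ k) ∧ ∑ k ∈ s, a k ^ r = 1 ∧
      c < ‖∑ k ∈ s, ((a k ^ (r - 1) : ℝ) : 𝕜) • g k‖ := by
  obtain ⟨u, t, hu, hut⟩ := exists_norming_isBlockSequence hg (half_pos hδ).le
    fun k => (half_lt_self hδ).trans_le (hδg k)
  obtain ⟨s, a, hsK, ha, hlt⟩ := exists_norm_sum_lt hu (fun k => (hut k).1) K
    (show 0 < δ / 2 / c by positivity)
  refine ⟨s, a, hsK, ha, ?_⟩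
  let G := ∑ k ∈ s, ((a k ^ (r - 1) : ℝ) : 𝕜) • g k
  let v := ∑ k ∈ s, ((a k : ℝ) : 𝕜) • u k
  have hpow : ∀ k, (a k : ℝ) ^ (r - 1) * a k = (a k : ℝ) ^ r := fun k => by
    simpa using (Real.rpow_add_of_nonneg (a k).2 (sub_nonneg.2 h.out) zero_le_one).symm
  have hGv : G v = ((∑ k ∈ s, (a k : ℝ) ^ r * t k : ℝ) : 𝕜) := by
    rw [hg.sum_smul_apply_sum_smul hu, RCLike.ofReal_sum]
    exact Finset.sum_congr rfl fun k _ => by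
      rw [(hut k).2.2, ← RCLike.ofReal_mul, hpow, ← RCLike.ofReal_mul]
  have hlow : δ / 2 ≤ ‖G‖ * ‖v‖ :=
    calc δ / 2 = ∑ k ∈ s, (a k : ℝ) ^ r * (δ / 2) := by
          rw [← Finset.sum_mul, show ∑ k ∈ s, (a k : ℝ) ^ r = 1 by exact_mod_cast ha, one_mul]
      _ ≤ ∑ k ∈ s, (a k : ℝ) ^ r * t k := by gcongr with k; exact (hut k).2.1
      _ ≤ ‖G v‖ := by rw [hGv, RCLike.norm_ofReal]; exact le_abs_self _
      _ ≤ ‖G‖ * ‖v‖ := G.le_opNorm v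
  by_contra! hGc
  have hup : ‖G‖ * ‖v‖ ≤ c * ‖v‖ := by gcongr
  exact (hlow.trans hup).not_gt ((lt_div_iff₀' hc).1 hlt)

theorem not_isSubsymmetricBasicSequence_dual (x : ℕ → StrongDual 𝕜 (TsirelsonSpace 𝕜 r)) :
    ¬ IsSubsymmetricBasicSequence 𝕜 x := by
  intro hx
  have hE : IsHomogeneousNorm 𝕜 (StrongDual 𝕜 (TsirelsonSpace 𝕜 r)) 1 :=
    ⟨one_pos, fun c f => by rw [norm_smul, Real.rpow_one]⟩
  obtain ⟨N, g, δ, B, hg, hspread, hδ, hgδB⟩ :=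
    hx.exists_spreading_blocks hE (dualBasis 𝕜 r)
  obtain ⟨θ, hθ, hlarge⟩ := exists_strictMono_card_le
    (P := fun k s (a : ℕ → ℝ≥0) => ∑ n ∈ s, a n ^ r = 1 ∧
      (k + 1 : ℝ) < ‖∑ n ∈ s, ((a n ^ (r - 1) : ℝ) : 𝕜) • g n‖) fun k K =>
        exists_lt_norm_sum_smul_dual hg hδ (fun k => (hgδB k).1) K (by positivity)
  obtain ⟨C, hC, hCg⟩ := (hspread θ hθ).2.exists_norm_sum_le
  obtain ⟨k, hk⟩ := exists_nat_gt (C * (2 * B))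
  obtain ⟨s, a, ⟨ha, hlt⟩, hs⟩ := hlarge k
  have hup : C * ‖∑ n ∈ s, ((a n ^ (r - 1) : ℝ) : 𝕜) • g (θ n)‖ ≤ C * (2 * B) := by
    gcongr
    exact norm_sum_smul_dual_le hg (fun k => (hgδB k).2) hθ hs ha
  have hle := hCg s fun n => ((a n ^ (r - 1) : ℝ) : 𝕜)
  simp only [Function.comp_apply] at hle
  linarith

end TsirelsonSpace

theorem mainTheorem7 (𝕜 : Type*) [RCLike 𝕜] (r : ℝ) [Fact (0 < r)] (s : ℝ≥0∞) [Fact (1 < s)] :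
    (¬ ∃ x : ℕ → TsirelsonSpace 𝕜 r, IsSubsymmetricBasicSequence 𝕜 x) ∧
      (¬ ∃ x : ℕ → TsirelsonDual 𝕜 s, IsSubsymmetricBasicSequence 𝕜 x) :=
  ⟨fun ⟨x, hx⟩ => TsirelsonSpace.not_isSubsymmetricBasicSequence x hx,
    fun ⟨x, hx⟩ => TsirelsonSpace.not_isSubsymmetricBasicSequence_dual x hx⟩
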